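/- Let $n\ge 2$ be an integer, let $p>q>0$ be real numbers, and let $f(s)=s^p-s^q$ for $s\ge 0$. For $0<a<b\le\infty$ consider the radial Dirichlet problem $$u''(r)+\frac{n-1}{r}\,u'(r)+f(u(r))=0\quad (a<r<b),\qquad u(a)=u(b)=0, \tag{R}$$ where for $b=\infty$ the condition $u(b)=0$ means $\lim_{r\to\infty}u(r)=0$. A positive solution of (R) is a function $u$ that is continuous on $[a,b]$ (on $[a,\infty)$ if $b=\infty$), twice differentiable and positive on $(a,b)$, and satisfies (R). For $n>2$ set $$P(q)=\frac{2(q+1)+\sqrt{(n+2)(q+1)\bigl(n+2-(n-2)q\bigr)}}{n}.$$ Assume that one of the following conditions holds: (i) $n>2$, $0<q\le \dfrac{4}{n-2}$ and $q<p\le \dfrac{n+2}{n-2}$; (ii) $n>2$, $\dfrac{4}{n-2}<q<\dfrac{4+\sqrt{2n(n+2)}}{2(n-2)}$ and $q<p\le P(q)$; (iii) $n=2$ and $0<q<p$. Then problem (R) with $b=\infty$ has at most one positive solution for every $a\in(0,\infty)$. If moreover $p>1$, then problem (R) has at most one positive solution for every $a$ and $b$ with $0<a<b<\infty$. -/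

import Mathlib

open Set Filter Topology

/-- The nonlinearity `f(s) = s^p - s^q` (only its values at `s ≥ 0` are ever used). -/
noncomputable def powerDiff (p q s : ℝ) : ℝ := s ^ p - s ^ q

/-- `u` is a classical solution of `u'' + (n - 1) / r * u' + f(u) = 0` on the set `I`
(below, `I` is always an open interval contained in `(0, ∞)`). -/
structure SolvesRadialEq (n : ℕ) (f : ℝ → ℝ) (I : Set ℝ) (u : ℝ → ℝ) : Prop where
  differentiable : ∀ r ∈ I, DifferentiableAt ℝ u r
  twice_differentiable : ∀ r ∈ I, DifferentiableAt ℝ (deriv u) r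
  equation : ∀ r ∈ I, deriv (deriv u) r + ((n : ℝ) - 1) / r * deriv u r + f (u r) = 0

/-- `u` is a positive solution of the radial Dirichlet problem on the annulus `a < r < b`,
`b < ∞`: `u` is continuous on `[a, b]`, solves the equation and is positive in `(a, b)`, and
`u(a) = u(b) = 0`. -/
structure IsPositiveAnnulusSolution (n : ℕ) (f : ℝ → ℝ) (a b : ℝ) (u : ℝ → ℝ) : Prop where
  continuousOn : ContinuousOn u (Icc a b)
  solves : SolvesRadialEq n f (Ioo a b) u
  pos : ∀ r ∈ Ioo a b, 0 < u r
  left : u a = 0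
  right : u b = 0

/-- `u` is a positive solution of the radial Dirichlet problem on the exterior domain `r > a`
(the case `b = ∞`): `u` is continuous on `[a, ∞)`, solves the equation and is positive in
`(a, ∞)`, `u(a) = 0`, and `u(r) → 0` as `r → ∞`. -/
structure IsPositiveExteriorSolution (n : ℕ) (f : ℝ → ℝ) (a : ℝ) (u : ℝ → ℝ) : Prop where
  continuousOn : ContinuousOn u (Ici a)
  solves : SolvesRadialEq n f (Ioi a) u
  pos : ∀ r ∈ Ioi a, 0 < u r
  left : u a = 0
  decay : Tendsto u atTop (𝓝 0)

/-- `P(q) = (2(q+1) + √((n+2)(q+1)(n+2-(n-2)q))) / n`. -/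
noncomputable def criticalP (n : ℕ) (q : ℝ) : ℝ :=
  (2 * (q + 1) + √(((n : ℝ) + 2) * (q + 1) * ((n : ℝ) + 2 - ((n : ℝ) - 2) * q))) / n

/-! Write n = k + 2 and let F be the primitive of f vanishing at 0, with positive zero β > 1. The
energy u'² + 2F(u) decreases in r and is positive for a positive solution. Hence u > β at every
critical point, each critical point is a strict maximum, and u consists of one increasing and one
decreasing branch (`IsPositiveRadial.exists_bump`). Each branch is described by functions of the
value s: the radius R and the modulus Y of the slope.

Take two solutions with slopes α₁ ≤ α₂ at a. If α₁ = α₂ they coincide. In the variable s the term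
f(s) is the same for both branches, so f need not be Lipschitz at 0.

If α₁ < α₂, the second solution stays steeper on the way up, arrives at each value earlier and has
the higher peak. On the way down it must end up strictly ahead: near the value 0 its radius is
smaller by a fixed c > 0, and r|v'| ≥ c (`IsBump.separation`). On an annulus this contradicts the
common end point b. On an exterior domain r|v'| ≥ c forces v ≤ C - c log r, which contradicts
positivity.

Three tools act on the descent. Sturm comparison at level 1, based on the monotonicity of f(s)/(s -
1) for s > 1, makes the decreasing branches cross above 1 unless the second is already ahead at the
height of the lower peak. Above β, the Pohozaev functional, monotone because (F/f)' ≥ (n-2)/(2n),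
together with the ratio P₂ - (Q₂/Q₁)P₁ (Q the flux), keeps the second branch steeper. Below β, where
F ≤ 0, the functional R√(Y² + 2F) does so.

For f = s^p - s^q the bound on (F/f)' is the nonnegativity of a quadratic polynomial in t = s^(p-q),
and the parameter ranges ensure it. The monotonicity of f(s)/(s - 1) uses p > 1. In the exterior
problem this is automatic, since for q < 1 no positive solution exists
(`IsPositiveRadial.not_exterior_of_lt_one`). -/

section Calculus

/-! ### Monotonicity, first and last zeros, Gronwall -/

variable {φ φ' : ℝ → ℝ} {a b l : ℝ}

theorem lt_of_hasDerivAt_pos (hab : a < b) (hd : ∀ x ∈ Icc a b, HasDerivAt φ (φ' x) x)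
    (hp : ∀ x ∈ Ioo a b, 0 < φ' x) : φ a < φ b := by
  obtain ⟨c, hc, h⟩ := exists_hasDerivAt_eq_slope φ φ' hab
    (fun x hx => (hd x hx).continuousAt.continuousWithinAt)
    (fun x hx => hd x (Ioo_subset_Icc_self hx))
  have := hp c hc
  rw [h] at this
  have h2 : 0 < b - a := sub_pos.2 hab
  have := (div_pos_iff_of_pos_right h2).1 this
  linarith

theorem le_of_hasDerivAt_nonneg (hab : a ≤ b) (hd : ∀ x ∈ Icc a b, HasDerivAt φ (φ' x) x)
    (hp : ∀ x ∈ Ioo a b, 0 ≤ φ' x) : φ a ≤ φ b := by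
  rcases hab.eq_or_lt with rfl | hab
  · exact le_rfl
  obtain ⟨c, hc, h⟩ := exists_hasDerivAt_eq_slope φ φ' hab
    (fun x hx => (hd x hx).continuousAt.continuousWithinAt)
    (fun x hx => hd x (Ioo_subset_Icc_self hx))
  have := hp c hc
  rw [h] at this
  have h2 : 0 < b - a := sub_pos.2 hab
  have := (le_div_iff₀ h2).1 this
  linarith

theorem lt_of_hasDerivAt_neg (hab : a < b) (hd : ∀ x ∈ Icc a b, HasDerivAt φ (φ' x) x)
    (hp : ∀ x ∈ Ioo a b, φ' x < 0) : φ b < φ a := by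
  have := lt_of_hasDerivAt_pos (φ := fun x => -φ x) (φ' := fun x => -φ' x) hab
    (fun x hx => (hd x hx).neg) (fun x hx => neg_pos.2 (hp x hx))
  linarith

theorem le_of_hasDerivAt_nonpos (hab : a ≤ b) (hd : ∀ x ∈ Icc a b, HasDerivAt φ (φ' x) x)
    (hp : ∀ x ∈ Ioo a b, φ' x ≤ 0) : φ b ≤ φ a := by
  have := le_of_hasDerivAt_nonneg (φ := fun x => -φ x) (φ' := fun x => -φ' x) hab
    (fun x hx => (hd x hx).neg) (fun x hx => neg_nonneg.2 (hp x hx))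
  linarith

/-- A function with nonnegative derivative stays above its limit at the left end point. -/
theorem limit_le_of_hasDerivAt_nonneg (hl : Tendsto φ (𝓝[>] a) (𝓝 l))
    (hd : ∀ x ∈ Ioc a b, HasDerivAt φ (φ' x) x) (hp : ∀ x ∈ Ioo a b, 0 ≤ φ' x) (hab : a < b) :
    l ≤ φ b := by
  refine le_of_tendsto hl ?_
  filter_upwards [Ioo_mem_nhdsGT hab] with x hx
  exact le_of_hasDerivAt_nonneg hx.2.le (fun y hy => hd y ⟨hx.1.trans_le hy.1, hy.2⟩)
    (fun y hy => hp y ⟨hx.1.trans hy.1, hy.2⟩)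

theorem limit_lt_of_hasDerivAt_pos (hl : Tendsto φ (𝓝[>] a) (𝓝 l))
    (hd : ∀ x ∈ Ioc a b, HasDerivAt φ (φ' x) x) (hp : ∀ x ∈ Ioo a b, 0 < φ' x) (hab : a < b) :
    l < φ b := by
  obtain ⟨c, hac, hcb⟩ := exists_between hab
  refine (limit_le_of_hasDerivAt_nonneg hl (fun x hx => hd x ⟨hx.1, hx.2.trans hcb.le⟩)
    (fun x hx => (hp x ⟨hx.1, hx.2.trans hcb⟩).le) hac).trans_lt ?_
  exact lt_of_hasDerivAt_pos hcb (fun y hy => hd y ⟨hac.trans_le hy.1, hy.2⟩)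
    (fun y hy => hp y ⟨hac.trans hy.1, hy.2⟩)

/-- A function with nonpositive derivative stays above its limit at the right end point. -/
theorem limit_le_of_hasDerivAt_nonpos (hl : Tendsto φ (𝓝[<] b) (𝓝 l))
    (hd : ∀ x ∈ Ico a b, HasDerivAt φ (φ' x) x) (hp : ∀ x ∈ Ioo a b, φ' x ≤ 0) (hab : a < b) :
    l ≤ φ a := by
  refine le_of_tendsto hl ?_
  filter_upwards [Ioo_mem_nhdsLT hab] with x hx
  exact le_of_hasDerivAt_nonpos hx.1.le (fun y hy => hd y ⟨hy.1, hy.2.trans_lt hx.2⟩)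
    (fun y hy => hp y ⟨hy.1, hy.2.trans hx.2⟩)

theorem limit_lt_of_hasDerivAt_neg (hl : Tendsto φ (𝓝[<] b) (𝓝 l))
    (hd : ∀ x ∈ Ico a b, HasDerivAt φ (φ' x) x) (hp : ∀ x ∈ Ioo a b, φ' x < 0) (hab : a < b) :
    l < φ a := by
  obtain ⟨c, hac, hcb⟩ := exists_between hab
  refine (limit_le_of_hasDerivAt_nonpos hl (fun x hx => hd x ⟨hac.le.trans hx.1, hx.2⟩)
    (fun x hx => (hp x ⟨hac.trans hx.1, hx.2⟩).le) hcb).trans_lt ?_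
  exact lt_of_hasDerivAt_neg hac (fun y hy => hd y ⟨hy.1, hy.2.trans_lt hcb⟩)
    (fun y hy => hp y ⟨hy.1, hy.2.trans hcb⟩)

/-- A continuous function that is positive near the right end point and has no last zero
is positive. -/
theorem pos_of_no_last_zero (hc : ContinuousOn φ (Ico a b)) (h0 : ∀ᶠ s in 𝓝[<] b, 0 < φ s)
    (hz : ∀ s ∈ Ico a b, (∀ t ∈ Ioo s b, 0 < φ t) → φ s ≠ 0) : ∀ s ∈ Ico a b, 0 < φ s := by
  intro s hs
  by_contra hneg
  rw [not_lt] at hneg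
  obtain ⟨c, hc1, hc2⟩ := (mem_nhdsLT_iff_exists_Ioo_subset).1 h0
  have hcb : c < b := hc1
  have hsub : Icc s (max s c) ⊆ Ico a b :=
    fun x hx => ⟨hs.1.trans hx.1, hx.2.trans_lt (max_lt hs.2 hcb)⟩
  have hclosed : IsCompact (Icc s (max s c) ∩ φ ⁻¹' Iic 0) :=
    isCompact_Icc.of_isClosed_subset ((hc.mono hsub).preimage_isClosed_of_isClosed isClosed_Icc
      isClosed_Iic) inter_subset_left
  obtain ⟨z, ⟨hz1, hz2⟩, hzmax⟩ := hclosed.exists_isGreatest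
    ⟨s, ⟨le_rfl, le_max_left _ _⟩, hneg⟩
  have hzI := hsub hz1
  have hpos : ∀ t ∈ Ioo z b, 0 < φ t := by
    intro t ht
    by_contra hn
    rw [not_lt] at hn
    by_cases htc : t ≤ max s c
    · exact absurd (hzmax ⟨⟨hz1.1.trans ht.1.le, htc⟩, hn⟩) (not_le.2 ht.1)
    · rw [not_le] at htc
      exact absurd (hc2 ⟨(le_max_right _ _).trans_lt htc, ht.2⟩) (not_lt.2 hn)
  have h1 := hz z hzI hpos
  have h2 : 0 ≤ φ z := by
    have hcz : Tendsto φ (𝓝[>] z) (𝓝 (φ z)) := by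
      refine (hc z hzI).mono_left ?_
      refine nhdsWithin_le_iff.2 ?_
      filter_upwards [Ioo_mem_nhdsGT hzI.2] with x hx
      exact ⟨hzI.1.trans hx.1.le, hx.2⟩
    refine ge_of_tendsto hcz ?_
    filter_upwards [Ioo_mem_nhdsGT hzI.2] with x hx
    exact (hpos x hx).le
  exact h1 (le_antisymm hz2 h2)

/-- A continuous function that is positive near the left end point and has no first zero
is positive. -/
theorem pos_of_no_first_zero (hc : ContinuousOn φ (Ioc a b)) (h0 : ∀ᶠ s in 𝓝[>] a, 0 < φ s)
    (hz : ∀ s ∈ Ioc a b, (∀ t ∈ Ioo a s, 0 < φ t) → φ s ≠ 0) : ∀ s ∈ Ioc a b, 0 < φ s := by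
  have key := pos_of_no_last_zero (φ := fun x => φ (-x)) (a := -b) (b := -a)
    (hc.comp continuous_neg.continuousOn
      (fun x hx => ⟨lt_neg.1 hx.2, neg_le.1 hx.1⟩))
    ((tendsto_neg_nhdsLT_neg (a := a)).eventually h0)
    (fun s hs h => hz (-s) ⟨lt_neg.1 hs.2, neg_le.1 hs.1⟩ fun t ht => by
      have := h (-t) ⟨lt_neg.1 ht.2, neg_lt_neg ht.1⟩
      simpa using this)
  intro s hs
  have := key (-s) ⟨neg_le_neg hs.2, neg_lt_neg hs.1⟩
  simpa using this

/-- The last zero of a continuous function that is positive near the right end point. -/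
theorem exists_last_zero (hc : ContinuousOn φ (Ico a b)) (h0 : ∀ᶠ s in 𝓝[<] b, 0 < φ s)
    (hz : ∃ s ∈ Ico a b, φ s ≤ 0) : ∃ s ∈ Ico a b, φ s = 0 ∧ ∀ t ∈ Ioo s b, 0 < φ t := by
  by_contra hcon
  push Not at hcon
  obtain ⟨s, hs, hs0⟩ := hz
  refine not_lt.2 hs0 (pos_of_no_last_zero hc h0 (fun t ht h h' => ?_) s hs)
  obtain ⟨x, hx, hx0⟩ := hcon t ht h'
  exact not_lt.2 hx0 (h x hx)

/-- Gronwall: a nonnegative function with `D' ≤ L D` and limit `0` at the left end vanishes. -/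
theorem eq_zero_of_hasDerivAt_le_mul {L : ℝ} (hl : Tendsto φ (𝓝[>] a) (𝓝 0))
    (hd : ∀ x ∈ Ioc a b, HasDerivAt φ (φ' x) x) (hp : ∀ x ∈ Ioo a b, φ' x ≤ L * φ x)
    (h0 : ∀ x ∈ Ioc a b, 0 ≤ φ x) (hab : a < b) : φ b = 0 := by
  refine le_antisymm ?_ (h0 b ⟨hab, le_rfl⟩)
  have hlim : Tendsto (fun x => -(φ x * Real.exp (-L * x))) (𝓝[>] a) (𝓝 0) := by
    have he : Tendsto (fun x => Real.exp (-L * x)) (𝓝[>] a) (𝓝 (Real.exp (-L * a))) :=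
      (Continuous.tendsto (by fun_prop) a).mono_left nhdsWithin_le_nhds
    simpa using (hl.mul he).neg
  have := limit_le_of_hasDerivAt_nonneg hlim
    (φ' := fun x => -(φ' x * Real.exp (-L * x) + φ x * (Real.exp (-L * x) * (-L * 1))))
    (fun x hx => ((hd x hx).mul (((hasDerivAt_id x).const_mul (-L)).exp)).neg)
    (fun x hx => by
      have h1 := hp x hx
      have h2 := Real.exp_pos (-L * x)
      nlinarith) hab
  have h2 := Real.exp_pos (-L * b)
  nlinarith

end Calculus

/-! ### Branches parametrised by the value, and their functionals -/

/-- A monotone branch of a radial solution in dimension `k + 2`, parametrised by the value `s`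
of the solution: `R s` is the radius where the value `s` is taken, `Y s` is the modulus of the
slope there, and `σ = ±1` is the sign of the slope. -/
structure IsBranch (k : ℕ) (f : ℝ → ℝ) (σ M : ℝ) (R Y : ℝ → ℝ) : Prop where
  R_pos : ∀ s ∈ Ioo 0 M, 0 < R s
  Y_pos : ∀ s ∈ Ioo 0 M, 0 < Y s
  hasDerivAt_R : ∀ s ∈ Ioo 0 M, HasDerivAt R (σ / Y s) s
  hasDerivAt_Y : ∀ s ∈ Ioo 0 M, HasDerivAt Y (-(σ * (k + 1)) / R s - f s / Y s) s

/-- The flux `r ^ (n - 1) |u'|` along a branch. -/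
def branchFlux (k : ℕ) (R Y : ℝ → ℝ) (s : ℝ) : ℝ := R s ^ (k + 1) * Y s

/-- Twice the energy along a branch. -/
def branchEnergy (F Y : ℝ → ℝ) (s : ℝ) : ℝ := Y s ^ 2 + 2 * F s

/-- The Pohozaev functional along a branch. -/
noncomputable def branchPohozaev (k : ℕ) (f F : ℝ → ℝ) (σ : ℝ) (R Y : ℝ → ℝ) (s : ℝ) : ℝ :=
  R s ^ (k + 2) * branchEnergy F Y s + σ * (2 * (k + 2)) * branchFlux k R Y s * (F s / f s)

namespace IsBranch

variable {k : ℕ} {f F : ℝ → ℝ} {σ M s : ℝ} {R Y : ℝ → ℝ}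

theorem flux_pos (hb : IsBranch k f σ M R Y) (hs : s ∈ Ioo 0 M) : 0 < branchFlux k R Y s :=
  mul_pos (pow_pos (hb.R_pos s hs) _) (hb.Y_pos s hs)

theorem hasDerivAt_flux (hb : IsBranch k f σ M R Y) (hs : s ∈ Ioo 0 M) :
    HasDerivAt (branchFlux k R Y) (-(R s ^ (k + 1) * f s / Y s)) s := by
  have hR := (hb.R_pos s hs).ne'
  have hY := (hb.Y_pos s hs).ne'
  refine (((hb.hasDerivAt_R s hs).pow (k + 1)).mul (hb.hasDerivAt_Y s hs)).congr_deriv ?_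
  simp only [Pi.pow_apply, Nat.add_sub_cancel]
  push_cast
  field_simp
  ring

theorem hasDerivAt_flux_sq (hb : IsBranch k f σ M R Y) (hs : s ∈ Ioo 0 M) :
    HasDerivAt (fun s => branchFlux k R Y s ^ 2) (-(2 * (R s ^ (k + 1)) ^ 2 * f s)) s := by
  have hY := (hb.Y_pos s hs).ne'
  refine ((hb.hasDerivAt_flux hs).pow 2).congr_deriv ?_
  simp only [branchFlux]
  field_simp
  push_cast
  ring

theorem hasDerivAt_energy (hb : IsBranch k f σ M R Y) (hF : HasDerivAt F (f s) s)
    (hs : s ∈ Ioo 0 M) :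
    HasDerivAt (branchEnergy F Y) (-(2 * σ * (k + 1) * Y s / R s)) s := by
  have hR := (hb.R_pos s hs).ne'
  have hY := (hb.Y_pos s hs).ne'
  refine (((hb.hasDerivAt_Y s hs).pow 2).add (hF.const_mul 2)).congr_deriv ?_
  field_simp
  push_cast
  ring

/-- The weight r^(2(n-1)) cancels the Y² term, so the derivative has the sign of σF, which is known
on either side of β. -/
theorem hasDerivAt_weighted_energy (hb : IsBranch k f σ M R Y) (hF : HasDerivAt F (f s) s)
    (hs : s ∈ Ioo 0 M) :
    HasDerivAt (fun s => (R s ^ (k + 1)) ^ 2 * branchEnergy F Y s)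
      (4 * σ * (k + 1) * (R s ^ (2 * k + 1) * (F s / Y s))) s := by
  have hR := (hb.R_pos s hs).ne'
  have hY := (hb.Y_pos s hs).ne'
  refine ((((hb.hasDerivAt_R s hs).pow (k + 1)).pow 2).mul
    (hb.hasDerivAt_energy hF hs)).congr_deriv ?_
  simp only [Pi.pow_apply, Nat.add_sub_cancel, branchEnergy]
  push_cast
  field_simp
  ring

/-- The coefficient F/f of the flux is chosen so that every remaining term is a multiple of the
flux. The lower bound on (F/f)' then fixes the sign. -/
theorem hasDerivAt_pohozaev (hb : IsBranch k f σ M R Y) (hF : HasDerivAt F (f s) s) (hf : f s ≠ 0)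
    {h : ℝ} (hh : HasDerivAt (fun s => F s / f s) h s) (hs : s ∈ Ioo 0 M) :
    HasDerivAt (branchPohozaev k f F σ R Y)
      (σ * ((2 * (k + 2) * h - k) * branchFlux k R Y s)) s := by
  have hR := (hb.R_pos s hs).ne'
  have hY := (hb.Y_pos s hs).ne'
  refine ((((hb.hasDerivAt_R s hs).pow (k + 2)).mul (hb.hasDerivAt_energy hF hs)).add
    (((hb.hasDerivAt_flux hs).const_mul (σ * (2 * (k + 2)))).mul hh)).congr_deriv ?_
  simp only [Pi.pow_apply, branchEnergy, branchFlux, show k + 2 - 1 = k + 1 from rfl]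
  push_cast
  field_simp
  ring

theorem hasDerivAt_virial (hb : IsBranch k f (-1) M R Y) (hF : HasDerivAt F (f s) s)
    (he : 0 < branchEnergy F Y s) (hs : s ∈ Ioo 0 M) :
    HasDerivAt (fun s => R s * √(branchEnergy F Y s))
      ((k * Y s ^ 2 - 2 * F s) / (Y s * √(branchEnergy F Y s))) s := by
  have hR := (hb.R_pos s hs).ne'
  have hY := (hb.Y_pos s hs).ne'
  have hq := (Real.sqrt_pos.2 he).ne'
  refine ((hb.hasDerivAt_R s hs).mul ((hb.hasDerivAt_energy hF hs).sqrt he.ne')).congr_deriv ?_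
  have h2 : √(branchEnergy F Y s) ^ 2 = Y s ^ 2 + 2 * F s := Real.sq_sqrt he.le
  field_simp
  rw [h2]
  ring

end IsBranch

/-- The properties of a nonlinearity `f` with primitive `F` that are used in dimension `k + 2`:
`f` is nonpositive below `1` and positive above, `F` is nonpositive below `β` and positive above,
and `(F / f)' ≥ (n - 2) / (2 n)` above `1`. -/
structure IsAdmissible (k : ℕ) (f F : ℝ → ℝ) (β : ℝ) : Prop where
  one_lt : 1 < β
  hasDerivAt : ∀ s, 0 < s → HasDerivAt F (f s) s
  tendsto_zero : Tendsto F (𝓝[>] 0) (𝓝 0)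
  F_nonpos : ∀ s ∈ Ioc 0 β, F s ≤ 0
  F_eq_zero : F β = 0
  F_pos : ∀ s, β < s → 0 < F s
  f_nonpos : ∀ s ∈ Ioc 0 1, f s ≤ 0
  f_pos : ∀ s, 1 < s → 0 < f s
  pohozaev : ∀ s, 1 < s → ∃ h, HasDerivAt (fun s => F s / f s) h s ∧ (k : ℝ) ≤ 2 * (k + 2) * h

/-- The two monotone branches `(R, Y)` (increasing) and `(R', Y')` (decreasing) of a
one-bump solution vanishing with slope `α` at radius `a`, with maximum `M` at radius `m`. -/
structure IsBump (k : ℕ) (f F : ℝ → ℝ) (a M m α : ℝ) (R Y R' Y' : ℝ → ℝ) : Prop where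
  up : IsBranch k f 1 M R Y
  down : IsBranch k f (-1) M R' Y'
  energy_up : ∀ s ∈ Ioo 0 M, 0 < branchEnergy F Y s
  energy_down : ∀ s ∈ Ioo 0 M, 0 < branchEnergy F Y' s
  slope_pos : 0 < α
  tendsto_R_zero : Tendsto R (𝓝[>] 0) (𝓝 a)
  tendsto_Y_zero : Tendsto Y (𝓝[>] 0) (𝓝 α)
  tendsto_R_max : Tendsto R (𝓝[<] M) (𝓝 m)
  tendsto_R'_max : Tendsto R' (𝓝[<] M) (𝓝 m)
  tendsto_Y_max : Tendsto Y (𝓝[<] M) (𝓝 0)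
  tendsto_Y'_max : Tendsto Y' (𝓝[<] M) (𝓝 0)
  peak_pos : 0 < m

/-! ### Comparison of the increasing branches -/

section Up

variable {k : ℕ} {f F : ℝ → ℝ} {β a M₁ M₂ α₁ α₂ s : ℝ} {R₁ Y₁ R₂ Y₂ : ℝ → ℝ}

theorem up_radius_lt (hu : IsBranch k f 1 M₁ R₁ Y₁) (hv : IsBranch k f 1 M₂ R₂ Y₂)
    (hR₁ : Tendsto R₁ (𝓝[>] 0) (𝓝 a)) (hR₂ : Tendsto R₂ (𝓝[>] 0) (𝓝 a))
    (h0 : 0 < s) (hs₁ : s < M₁) (hs₂ : s < M₂) (h : ∀ t ∈ Ioo 0 s, Y₁ t < Y₂ t) :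
    R₂ s < R₁ s := by
  have hl : Tendsto (fun t => R₁ t - R₂ t) (𝓝[>] 0) (𝓝 0) := by simpa using hR₁.sub hR₂
  have := limit_lt_of_hasDerivAt_pos hl (φ' := fun t => 1 / Y₁ t - 1 / Y₂ t)
    (fun t ht => (hu.hasDerivAt_R t ⟨ht.1, ht.2.trans_lt hs₁⟩).sub
      (hv.hasDerivAt_R t ⟨ht.1, ht.2.trans_lt hs₂⟩))
    (fun t ht => sub_pos.2 (one_div_lt_one_div_of_lt (hu.Y_pos t ⟨ht.1, ht.2.trans hs₁⟩) (h t ht)))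
    h0
  linarith

/-- Below β the weighted energy decreases along both branches, and it decreases more slowly along
the second one, which has smaller radius and larger slope. -/
theorem up_weighted_energy_lt (hA : IsAdmissible k f F β) (ha : 0 < a) (hα : 0 < α₁)
    (hα₂ : α₁ < α₂) (hu : IsBranch k f 1 M₁ R₁ Y₁) (hv : IsBranch k f 1 M₂ R₂ Y₂)
    (hR₁ : Tendsto R₁ (𝓝[>] 0) (𝓝 a)) (hR₂ : Tendsto R₂ (𝓝[>] 0) (𝓝 a))
    (hY₁ : Tendsto Y₁ (𝓝[>] 0) (𝓝 α₁)) (hY₂ : Tendsto Y₂ (𝓝[>] 0) (𝓝 α₂))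
    (h0 : 0 < s) (hs₁ : s < M₁) (hs₂ : s < M₂) (hsβ : s ≤ β) (h : ∀ t ∈ Ioo 0 s, Y₁ t < Y₂ t) :
    (R₁ s ^ (k + 1)) ^ 2 * branchEnergy F Y₁ s < (R₂ s ^ (k + 1)) ^ 2 * branchEnergy F Y₂ s := by
  have hF := hA.tendsto_zero.const_mul 2
  have hl := (((hR₂.pow (k + 1)).pow 2).mul ((hY₂.pow 2).add hF)).sub
    (((hR₁.pow (k + 1)).pow 2).mul ((hY₁.pow 2).add hF))
  have := limit_le_of_hasDerivAt_nonneg hl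
    (fun t ht => (hv.hasDerivAt_weighted_energy (hA.hasDerivAt t ht.1) ⟨ht.1, ht.2.trans_lt hs₂⟩).sub
      (hu.hasDerivAt_weighted_energy (hA.hasDerivAt t ht.1) ⟨ht.1, ht.2.trans_lt hs₁⟩))
    (fun t ht => by
      have hR := up_radius_lt hu hv hR₁ hR₂ ht.1 (ht.2.trans hs₁) (ht.2.trans hs₂)
        (fun x hx => h x ⟨hx.1, hx.2.trans ht.2⟩)
      have hp₂ := hv.R_pos t ⟨ht.1, ht.2.trans hs₂⟩
      have hy := hu.Y_pos t ⟨ht.1, ht.2.trans hs₁⟩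
      have hFt := hA.F_nonpos t ⟨ht.1, ht.2.le.trans hsβ⟩
      have hyy := h t ht
      have h1 : R₂ t ^ (2 * k + 1) * (-F t / Y₂ t) ≤ R₁ t ^ (2 * k + 1) * (-F t / Y₁ t) := by
        have : 0 ≤ -F t := by linarith
        have hp₁ := hp₂.trans hR
        have hy₂ := hy.trans hyy
        gcongr
      have h2 : 0 ≤ R₁ t ^ (2 * k + 1) * (-F t / Y₁ t) - R₂ t ^ (2 * k + 1) * (-F t / Y₂ t) := by
        linarith
      have h3 : (0 : ℝ) ≤ 4 * (k + 1) := by positivity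
      have h4 := mul_nonneg h3 h2
      refine le_of_le_of_eq h4 ?_
      simp only [neg_div]
      ring) h0
  have hpos : 0 < (a ^ (k + 1)) ^ 2 * (α₂ ^ 2 + 2 * 0) - (a ^ (k + 1)) ^ 2 * (α₁ ^ 2 + 2 * 0) := by
    have h1 : 0 < (a ^ (k + 1)) ^ 2 := by positivity
    have h2 : α₁ ^ 2 < α₂ ^ 2 := by gcongr
    nlinarith
  exact sub_pos.1 (hpos.trans_le this)

theorem flux_sq_of_F_eq_zero {β : ℝ} (hF : F β = 0) (R Y : ℝ → ℝ) :
    (R β ^ (k + 1)) ^ 2 * branchEnergy F Y β = branchFlux k R Y β ^ 2 := by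
  simp only [branchEnergy, branchFlux, hF]
  ring

/-- Above 1, where f > 0, the squared flux decreases at the rate 2R^(2(n-1))f, which is smaller for
the branch of smaller radius. -/
theorem up_flux_sq_le (hA : IsAdmissible k f F β) (hu : IsBranch k f 1 M₁ R₁ Y₁)
    (hv : IsBranch k f 1 M₂ R₂ Y₂)
    (hR₁ : Tendsto R₁ (𝓝[>] 0) (𝓝 a)) (hR₂ : Tendsto R₂ (𝓝[>] 0) (𝓝 a)) {s₀ : ℝ}
    (h0 : 1 < s₀) (hs : s₀ ≤ s) (hs₁ : s < M₁) (hs₂ : s < M₂) (h : ∀ t ∈ Ioo 0 s, Y₁ t < Y₂ t) :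
    branchFlux k R₂ Y₂ s₀ ^ 2 - branchFlux k R₁ Y₁ s₀ ^ 2 ≤
      branchFlux k R₂ Y₂ s ^ 2 - branchFlux k R₁ Y₁ s ^ 2 := by
  refine le_of_hasDerivAt_nonneg hs
    (fun t ht => (hv.hasDerivAt_flux_sq ⟨by linarith [ht.1], ht.2.trans_lt hs₂⟩).sub
      (hu.hasDerivAt_flux_sq ⟨by linarith [ht.1], ht.2.trans_lt hs₁⟩)) fun t ht => ?_
  have ht0 : 0 < t := by linarith [ht.1]
  have hR := up_radius_lt hu hv hR₁ hR₂ ht0 (ht.2.trans hs₁) (ht.2.trans hs₂)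
    (fun x hx => h x ⟨hx.1, hx.2.trans ht.2⟩)
  have hp₂ := hv.R_pos t ⟨ht0, ht.2.trans hs₂⟩
  have hf := hA.f_pos t (by linarith [ht.1])
  have h1 : (R₂ t ^ (k + 1)) ^ 2 ≤ (R₁ t ^ (k + 1)) ^ 2 := by gcongr
  nlinarith

theorem up_flux_lt (hA : IsAdmissible k f F β) (ha : 0 < a) (hα : 0 < α₁)
    (hα₂ : α₁ < α₂) (hu : IsBranch k f 1 M₁ R₁ Y₁) (hv : IsBranch k f 1 M₂ R₂ Y₂)
    (hR₁ : Tendsto R₁ (𝓝[>] 0) (𝓝 a)) (hR₂ : Tendsto R₂ (𝓝[>] 0) (𝓝 a))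
    (hY₁ : Tendsto Y₁ (𝓝[>] 0) (𝓝 α₁)) (hY₂ : Tendsto Y₂ (𝓝[>] 0) (𝓝 α₂))
    (hsβ : β ≤ s) (hs₁ : s < M₁) (hs₂ : s < M₂) (h : ∀ t ∈ Ioo 0 s, Y₁ t < Y₂ t) :
    branchFlux k R₁ Y₁ s < branchFlux k R₂ Y₂ s := by
  have hβ := hA.one_lt
  have h1 := up_weighted_energy_lt hA ha hα hα₂ hu hv hR₁ hR₂ hY₁ hY₂ (by linarith)
    (hsβ.trans_lt hs₁) (hsβ.trans_lt hs₂) le_rfl (fun t ht => h t ⟨ht.1, ht.2.trans_le hsβ⟩)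
  rw [flux_sq_of_F_eq_zero hA.F_eq_zero, flux_sq_of_F_eq_zero hA.F_eq_zero] at h1
  have h2 := up_flux_sq_le hA hu hv hR₁ hR₂ hβ hsβ hs₁ hs₂ h
  have h3 := hv.flux_pos (s := s) ⟨by linarith, hs₂⟩
  exact lt_of_pow_lt_pow_left₀ 2 h3.le (by linarith)

/-- At a first value of equal slopes the second radius is smaller, so its weighted energy and its
flux cannot be larger. This contradicts the energy comparison below β and the flux comparison above
β. -/
theorem up_slope_lt (hA : IsAdmissible k f F β) (ha : 0 < a) (hα : 0 < α₁)
    (hα₂ : α₁ < α₂) (hu : IsBranch k f 1 M₁ R₁ Y₁) (hv : IsBranch k f 1 M₂ R₂ Y₂)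
    (hE : ∀ s ∈ Ioo 0 M₁, 0 < branchEnergy F Y₁ s)
    (hR₁ : Tendsto R₁ (𝓝[>] 0) (𝓝 a)) (hR₂ : Tendsto R₂ (𝓝[>] 0) (𝓝 a))
    (hY₁ : Tendsto Y₁ (𝓝[>] 0) (𝓝 α₁)) (hY₂ : Tendsto Y₂ (𝓝[>] 0) (𝓝 α₂))
    (h0 : 0 < s) (hs₁ : s < M₁) (hs₂ : s < M₂) : Y₁ s < Y₂ s := by
  refine sub_pos.1 (pos_of_no_first_zero (φ := fun t => Y₂ t - Y₁ t) (a := 0) (b := s)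
    (fun t ht => ((hv.hasDerivAt_Y t ⟨ht.1, ht.2.trans_lt hs₂⟩).sub
      (hu.hasDerivAt_Y t ⟨ht.1, ht.2.trans_lt hs₁⟩)).continuousAt.continuousWithinAt)
    ((hY₂.sub hY₁).eventually (lt_mem_nhds (sub_pos.2 hα₂))) (fun t ht h heq => ?_) s ⟨h0, le_rfl⟩)
  have ht₁ := ht.2.trans_lt hs₁
  have ht₂ := ht.2.trans_lt hs₂
  have h' : ∀ x ∈ Ioo 0 t, Y₁ x < Y₂ x := fun x hx => sub_pos.1 (h x hx)
  have heq' : Y₂ t = Y₁ t := sub_eq_zero.1 heq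
  have hR := up_radius_lt hu hv hR₁ hR₂ ht.1 ht₁ ht₂ h'
  have hp₂ := hv.R_pos t ⟨ht.1, ht₂⟩
  rcases le_total t β with hβ | hβ
  · have := up_weighted_energy_lt hA ha hα hα₂ hu hv hR₁ hR₂ hY₁ hY₂ ht.1 ht₁ ht₂ hβ h'
    have he := hE t ⟨ht.1, ht₁⟩
    simp only [branchEnergy, heq'] at this he
    have h1 : (R₂ t ^ (k + 1)) ^ 2 ≤ (R₁ t ^ (k + 1)) ^ 2 := by gcongr
    nlinarith
  · have := up_flux_lt hA ha hα hα₂ hu hv hR₁ hR₂ hY₁ hY₂ hβ ht₁ ht₂ h'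
    have hy := hu.Y_pos t ⟨ht.1, ht₁⟩
    simp only [branchFlux, heq'] at this
    have h1 : R₂ t ^ (k + 1) ≤ R₁ t ^ (k + 1) := by gcongr
    nlinarith

end Up

theorem tendsto_flux_max (k : ℕ) {M m : ℝ} {R Y : ℝ → ℝ}
    (hR : Tendsto R (𝓝[<] M) (𝓝 m)) (hY : Tendsto Y (𝓝[<] M) (𝓝 0)) :
    Tendsto (branchFlux k R Y) (𝓝[<] M) (𝓝 0) := by
  have := (hR.pow (k + 1)).mul hY
  rwa [mul_zero] at this

section Bump

variable {k : ℕ} {f F : ℝ → ℝ} {β a M₁ M₂ m₁ m₂ α₁ α₂ : ℝ}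
  {R₁ Y₁ R₁' Y₁' R₂ Y₂ R₂' Y₂' : ℝ → ℝ}

/-- If the second peak were not higher, its flux would tend to 0 at M₂, although the gap between the
squared fluxes is positive at β and does not shrink. -/
theorem IsBump.max_lt_max (hA : IsAdmissible k f F β) (ha : 0 < a)
    (hu : IsBump k f F a M₁ m₁ α₁ R₁ Y₁ R₁' Y₁') (hv : IsBump k f F a M₂ m₂ α₂ R₂ Y₂ R₂' Y₂')
    (hα : α₁ < α₂) (hM₂ : β < M₂) : M₁ < M₂ := by
  by_contra hM
  rw [not_lt] at hM
  have hY : ∀ s, 0 < s → s < M₂ → Y₁ s < Y₂ s := fun s h0 h2 =>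
    up_slope_lt hA ha hu.slope_pos hα hu.up hv.up hu.energy_up hu.tendsto_R_zero hv.tendsto_R_zero
      hu.tendsto_Y_zero hv.tendsto_Y_zero h0 (h2.trans_le hM) h2
  have hβ := hA.one_lt
  have hβ₁ : branchFlux k R₁ Y₁ β < branchFlux k R₂ Y₂ β :=
    up_flux_lt hA ha hu.slope_pos hα hu.up hv.up hu.tendsto_R_zero hv.tendsto_R_zero
      hu.tendsto_Y_zero hv.tendsto_Y_zero le_rfl (hM₂.trans_le hM) hM₂
      (fun t ht => hY t ht.1 (ht.2.trans hM₂))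
  have hpos := hu.up.flux_pos (s := β) ⟨by linarith, hM₂.trans_le hM⟩
  have hlim := (tendsto_flux_max k hv.tendsto_R_max hv.tendsto_Y_max).pow 2
  have : branchFlux k R₂ Y₂ β ^ 2 - branchFlux k R₁ Y₁ β ^ 2 ≤ 0 ^ 2 := by
    refine ge_of_tendsto hlim ?_
    filter_upwards [Ioo_mem_nhdsLT hM₂] with s hs
    have := up_flux_sq_le hA hu.up hv.up hu.tendsto_R_zero hv.tendsto_R_zero hβ hs.1.le
      (hs.2.trans_le hM) hs.2 (fun t ht => hY t ht.1 (ht.2.trans hs.2))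
    have h2 := sq_nonneg (branchFlux k R₁ Y₁ s)
    linarith
  nlinarith

/-- At β the functional reduces to Q²/R^k, where the second branch has larger flux Q and smaller
radius. Above β its derivative is a nonnegative multiple of the flux. -/
theorem up_pohozaev_lt (hA : IsAdmissible k f F β) {s : ℝ} (hu : IsBranch k f 1 M₁ R₁ Y₁)
    (hv : IsBranch k f 1 M₂ R₂ Y₂) (hβs : β ≤ s) (hs₁ : s < M₁) (hs₂ : s < M₂)
    (hR : R₂ β < R₁ β)
    (hQ : ∀ t ∈ Icc β s, branchFlux k R₁ Y₁ t < branchFlux k R₂ Y₂ t) :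
    branchPohozaev k f F 1 R₁ Y₁ s < branchPohozaev k f F 1 R₂ Y₂ s := by
  have hβ := hA.one_lt
  choose! h hh using hA.pohozaev
  have h1 : branchPohozaev k f F 1 R₁ Y₁ β < branchPohozaev k f F 1 R₂ Y₂ β := by
    simp only [branchPohozaev, branchEnergy, hA.F_eq_zero]
    simp only [zero_div, mul_zero, add_zero]
    have hR₁ := hu.R_pos β ⟨by linarith, hβs.trans_lt hs₁⟩
    have hR₂ := hv.R_pos β ⟨by linarith, hβs.trans_lt hs₂⟩
    have hq := hQ β ⟨le_rfl, hβs⟩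
    have hq₁ := hu.flux_pos (s := β) ⟨by linarith, hβs.trans_lt hs₁⟩
    have hq2 : branchFlux k R₁ Y₁ β ^ 2 < branchFlux k R₂ Y₂ β ^ 2 := by gcongr
    have e₁ : branchFlux k R₁ Y₁ β ^ 2 = R₁ β ^ k * (R₁ β ^ (k + 2) * Y₁ β ^ 2) := by
      simp only [branchFlux]; ring
    have e₂ : branchFlux k R₂ Y₂ β ^ 2 = R₂ β ^ k * (R₂ β ^ (k + 2) * Y₂ β ^ 2) := by
      simp only [branchFlux]; ring
    rw [e₁, e₂] at hq2
    have h3 : R₂ β ^ k * (R₂ β ^ (k + 2) * Y₂ β ^ 2) ≤ R₁ β ^ k * (R₂ β ^ (k + 2) * Y₂ β ^ 2) := by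
      gcongr
    exact lt_of_mul_lt_mul_left (hq2.trans_le h3) (by positivity)
  have h2 := le_of_hasDerivAt_nonneg
    (φ := fun t => branchPohozaev k f F 1 R₂ Y₂ t - branchPohozaev k f F 1 R₁ Y₁ t) hβs
    (fun t ht => by
      have ht1 : 1 < t := hβ.trans_le ht.1
      have ht0 : 0 < t := by linarith
      exact (hv.hasDerivAt_pohozaev (hA.hasDerivAt t ht0) (hA.f_pos t ht1).ne' (hh t ht1).1
        ⟨ht0, ht.2.trans_lt hs₂⟩).sub (hu.hasDerivAt_pohozaev (hA.hasDerivAt t ht0)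
        (hA.f_pos t ht1).ne' (hh t ht1).1 ⟨ht0, ht.2.trans_lt hs₁⟩))
    (fun t ht => by
      have ht1 : 1 < t := hβ.trans ht.1
      have := (hh t ht1).2
      have := hQ t ⟨ht.1.le, ht.2.le⟩
      nlinarith)
  linarith

end Bump

/-! ### Comparison of the decreasing branches below β -/

section Down

variable {k : ℕ} {f F : ℝ → ℝ} {β M₁ M₂ s s₀ : ℝ} {R₁ Y₁ R₂ Y₂ : ℝ → ℝ}

/-- The quotient splits as κ·y/√(y² - c) + c/(y√(y² - c)), and for c ≥ 0 both terms decrease in y.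
It is applied with c = -2F, the derivative of R√(Y² + 2F) on a decreasing branch being of this form.
-/
theorem virial_kernel_antitone {κ c y₁ y₂ : ℝ} (hκ : 0 ≤ κ) (hc : 0 ≤ c) (hy₁ : 0 < y₁)
    (hy : y₁ ≤ y₂) (hcy : 0 < y₁ ^ 2 - c) :
    (κ * y₂ ^ 2 + c) / (y₂ * √(y₂ ^ 2 - c)) ≤ (κ * y₁ ^ 2 + c) / (y₁ * √(y₁ ^ 2 - c)) := by
  have hsq : y₁ ^ 2 ≤ y₂ ^ 2 := by gcongr
  have hcy₂ : 0 < y₂ ^ 2 - c := by linarith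
  have he₁ := Real.sqrt_pos.2 hcy
  have he₂ := Real.sqrt_pos.2 hcy₂
  have hee : √(y₁ ^ 2 - c) ≤ √(y₂ ^ 2 - c) := Real.sqrt_le_sqrt (by linarith)
  have hy₂ : 0 < y₂ := hy₁.trans_le hy
  have hr : y₂ / √(y₂ ^ 2 - c) ≤ y₁ / √(y₁ ^ 2 - c) := by
    rw [div_le_div_iff₀ he₂ he₁]
    refine le_of_sq_le_sq ?_ (by positivity)
    rw [mul_pow, mul_pow, Real.sq_sqrt hcy.le, Real.sq_sqrt hcy₂.le]
    nlinarith
  have key : ∀ y e : ℝ, 0 < y → 0 < e →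
      (κ * y ^ 2 + c) / (y * e) = κ * (y / e) + c / (y * e) := by
    intro y e hy he
    field_simp
  rw [key _ _ hy₂ he₂, key _ _ hy₁ he₁]
  gcongr

theorem down_radius_sub_le (hu : IsBranch k f (-1) M₁ R₁ Y₁) (hv : IsBranch k f (-1) M₂ R₂ Y₂)
    (h0 : 0 < s) (hs : s ≤ s₀) (hs₁ : s₀ < M₁) (hs₂ : s₀ < M₂)
    (h : ∀ t ∈ Ioo s s₀, Y₁ t < Y₂ t) : R₁ s₀ - R₂ s₀ ≤ R₁ s - R₂ s := by
  refine le_of_hasDerivAt_nonpos (φ := fun t => R₁ t - R₂ t) hs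
    (fun t ht => (hu.hasDerivAt_R t ⟨h0.trans_le ht.1, ht.2.trans_lt hs₁⟩).sub
      (hv.hasDerivAt_R t ⟨h0.trans_le ht.1, ht.2.trans_lt hs₂⟩)) fun t ht => ?_
  have := one_div_lt_one_div_of_lt (hu.Y_pos t ⟨h0.trans ht.1, ht.2.trans hs₁⟩) (h t ht)
  rw [neg_div, neg_div]
  linarith

theorem down_radius_sub_lt (hu : IsBranch k f (-1) M₁ R₁ Y₁) (hv : IsBranch k f (-1) M₂ R₂ Y₂)
    (h0 : 0 < s) (hs : s < s₀) (hs₁ : s₀ < M₁) (hs₂ : s₀ < M₂)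
    (h : ∀ t ∈ Ioo s s₀, Y₁ t < Y₂ t) : R₁ s₀ - R₂ s₀ < R₁ s - R₂ s := by
  refine lt_of_hasDerivAt_neg (φ := fun t => R₁ t - R₂ t) hs
    (fun t ht => (hu.hasDerivAt_R t ⟨h0.trans_le ht.1, ht.2.trans_lt hs₁⟩).sub
      (hv.hasDerivAt_R t ⟨h0.trans_le ht.1, ht.2.trans_lt hs₂⟩)) fun t ht => ?_
  have := one_div_lt_one_div_of_lt (hu.Y_pos t ⟨h0.trans ht.1, ht.2.trans hs₁⟩) (h t ht)
  rw [neg_div, neg_div]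
  linarith

theorem down_virial_sub_le (hA : IsAdmissible k f F β) (hu : IsBranch k f (-1) M₁ R₁ Y₁)
    (hv : IsBranch k f (-1) M₂ R₂ Y₂) (hE₁ : ∀ s ∈ Ioo 0 M₁, 0 < branchEnergy F Y₁ s)
    (hE₂ : ∀ s ∈ Ioo 0 M₂, 0 < branchEnergy F Y₂ s)
    (h0 : 0 < s) (hs : s ≤ s₀) (hsβ : s₀ ≤ β) (hs₁ : s₀ < M₁) (hs₂ : s₀ < M₂)
    (h : ∀ t ∈ Ioo s s₀, Y₁ t < Y₂ t) :
    R₂ s₀ * √(branchEnergy F Y₂ s₀) - R₁ s₀ * √(branchEnergy F Y₁ s₀) ≤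
      R₂ s * √(branchEnergy F Y₂ s) - R₁ s * √(branchEnergy F Y₁ s) := by
  refine le_of_hasDerivAt_nonpos
    (φ := fun s => R₂ s * √(branchEnergy F Y₂ s) - R₁ s * √(branchEnergy F Y₁ s)) hs
    (fun t ht => by
      have ht0 := h0.trans_le ht.1
      have ht₁ : t ∈ Ioo 0 M₁ := ⟨ht0, ht.2.trans_lt hs₁⟩
      have ht₂ : t ∈ Ioo 0 M₂ := ⟨ht0, ht.2.trans_lt hs₂⟩
      exact (hv.hasDerivAt_virial (hA.hasDerivAt t ht0) (hE₂ t ht₂) ht₂).sub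
        (hu.hasDerivAt_virial (hA.hasDerivAt t ht0) (hE₁ t ht₁) ht₁)) fun t ht => ?_
  have ht0 := h0.trans ht.1
  have hF := hA.F_nonpos t ⟨ht0, ht.2.le.trans hsβ⟩
  have he := hE₁ t ⟨ht0, ht.2.trans hs₁⟩
  have key := virial_kernel_antitone (κ := k) (c := -(2 * F t)) (Nat.cast_nonneg k) (by linarith)
    (hu.Y_pos t ⟨ht0, ht.2.trans hs₁⟩) (h t ht).le (by simpa [branchEnergy] using he)
  simp only [sub_neg_eq_add, ← sub_eq_add_neg] at key
  exact sub_nonpos.2 key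

/-- Once the virial functional of the second branch is larger at a value `s₀ ≤ β`, the radii
of the two branches separate for good. -/
theorem down_separation (hA : IsAdmissible k f F β) (hu : IsBranch k f (-1) M₁ R₁ Y₁)
    (hv : IsBranch k f (-1) M₂ R₂ Y₂) (hE₁ : ∀ s ∈ Ioo 0 M₁, 0 < branchEnergy F Y₁ s)
    (hE₂ : ∀ s ∈ Ioo 0 M₂, 0 < branchEnergy F Y₂ s)
    (h0 : 0 < s₀) (hsβ : s₀ ≤ β) (hs₁ : s₀ < M₁) (hs₂ : s₀ < M₂) (hR : R₂ s₀ ≤ R₁ s₀)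
    (hW : R₁ s₀ * √(branchEnergy F Y₁ s₀) < R₂ s₀ * √(branchEnergy F Y₂ s₀)) :
    ∃ c > 0, ∃ s₁ > 0, s₁ < M₁ ∧ s₁ < M₂ ∧
      ∀ s ∈ Ioo 0 s₁, R₂ s + c ≤ R₁ s ∧ c ≤ R₂ s * Y₂ s := by
  have hY₀ : Y₁ s₀ < Y₂ s₀ := by
    by_contra hn
    rw [not_lt] at hn
    have hp₂ := hv.Y_pos s₀ ⟨h0, hs₂⟩
    have hr₂ := hv.R_pos s₀ ⟨h0, hs₂⟩
    have : branchEnergy F Y₂ s₀ ≤ branchEnergy F Y₁ s₀ := by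
      simp only [branchEnergy]
      gcongr
    have h2 := Real.sqrt_le_sqrt this
    have h3 : R₂ s₀ * √(branchEnergy F Y₂ s₀) ≤ R₁ s₀ * √(branchEnergy F Y₁ s₀) := by
      gcongr
      exact (hu.R_pos s₀ ⟨h0, hs₁⟩).le
    linarith
  have hcont : ∀ t, 0 < t → t ≤ s₀ → ContinuousAt (fun t => Y₂ t - Y₁ t) t := fun t h0 ht =>
    ((hv.hasDerivAt_Y t ⟨h0, ht.trans_lt hs₂⟩).sub
      (hu.hasDerivAt_Y t ⟨h0, ht.trans_lt hs₁⟩)).continuousAt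
  -- At a value of equal slopes the energies agree, so a strictly larger virial would require a
  -- larger second radius. But the radius gap R₁ - R₂ has only grown since s₀.
  have hY : ∀ s, 0 < s → s < s₀ → Y₁ s < Y₂ s := by
    intro s h0s hs
    refine sub_pos.1 (pos_of_no_last_zero (φ := fun t => Y₂ t - Y₁ t) (a := s) (b := s₀)
      (fun t ht => (hcont t (h0s.trans_le ht.1) ht.2.le).continuousWithinAt)
      (((hcont s₀ h0 le_rfl).eventually (lt_mem_nhds (sub_pos.2 hY₀))).filter_mono
        nhdsWithin_le_nhds) (fun t ht h heq => ?_) s ⟨le_rfl, hs⟩)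
    have ht0 := h0s.trans_le ht.1
    have h' : ∀ x ∈ Ioo t s₀, Y₁ x < Y₂ x := fun x hx => sub_pos.1 (h x hx)
    have heq' : Y₂ t = Y₁ t := sub_eq_zero.1 heq
    have h1 := down_radius_sub_le hu hv ht0 ht.2.le hs₁ hs₂ h'
    have h2 := down_virial_sub_le hA hu hv hE₁ hE₂ ht0 ht.2.le hsβ hs₁ hs₂ h'
    have h3 := Real.sqrt_nonneg (branchEnergy F Y₁ t)
    have h4 : branchEnergy F Y₂ t = branchEnergy F Y₁ t := by simp only [branchEnergy, heq']
    rw [h4] at h2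
    nlinarith
  have hhalf : s₀ / 2 < s₀ := by linarith
  have hgap := down_radius_sub_lt hu hv (half_pos h0) hhalf hs₁ hs₂
    (fun t ht => hY t ((half_pos h0).trans ht.1) ht.2)
  -- The radii may agree at s₀, so the radius gap is measured at s₀ / 2; the virial gap is already
  -- strict at s₀.
  refine ⟨min (R₁ (s₀ / 2) - R₂ (s₀ / 2))
    (R₂ s₀ * √(branchEnergy F Y₂ s₀) - R₁ s₀ * √(branchEnergy F Y₁ s₀)),
    lt_min (by linarith) (by linarith), s₀ / 2, half_pos h0, by linarith, by linarith,
    fun s hs => ⟨?_, ?_⟩⟩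
  · have := down_radius_sub_le hu hv hs.1 hs.2.le (hhalf.trans hs₁) (hhalf.trans hs₂)
      (fun t ht => hY t (hs.1.trans ht.1) (ht.2.trans hhalf))
    have := min_le_left (R₁ (s₀ / 2) - R₂ (s₀ / 2))
      (R₂ s₀ * √(branchEnergy F Y₂ s₀) - R₁ s₀ * √(branchEnergy F Y₁ s₀))
    linarith
  · have hss : s < s₀ := hs.2.trans hhalf
    have h1 := down_virial_sub_le hA hu hv hE₁ hE₂ hs.1 hss.le hsβ hs₁ hs₂
      (fun t ht => hY t (hs.1.trans ht.1) ht.2)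
    have h2 := min_le_right (R₁ (s₀ / 2) - R₂ (s₀ / 2))
      (R₂ s₀ * √(branchEnergy F Y₂ s₀) - R₁ s₀ * √(branchEnergy F Y₁ s₀))
    have h3 : 0 ≤ R₁ s * √(branchEnergy F Y₁ s) :=
      mul_nonneg (hu.R_pos s ⟨hs.1, hss.trans hs₁⟩).le (Real.sqrt_nonneg _)
    have hy := hv.Y_pos s ⟨hs.1, hss.trans hs₂⟩
    have h4 : √(branchEnergy F Y₂ s) ≤ Y₂ s := by
      refine Real.sqrt_le_iff.2 ⟨hy.le, ?_⟩
      have := hA.F_nonpos s ⟨hs.1, hss.le.trans hsβ⟩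
      simp only [branchEnergy]
      linarith
    have h5 := mul_le_mul_of_nonneg_left h4 (hv.R_pos s ⟨hs.1, hss.trans hs₂⟩).le
    linarith

end Down

/-! ### The Pohozaev functional at the peak -/

section Peak

variable {k : ℕ} {f F : ℝ → ℝ} {β a M m α s σ : ℝ} {R Y R' Y' : ℝ → ℝ}

/-- The flux vanishes at the peak, so the limit does not depend on σ and is common to the two
branches of a bump. -/
theorem IsAdmissible.tendsto_pohozaev_max (hA : IsAdmissible k f F β) (hM : 1 < M) (σ : ℝ)
    (hR : Tendsto R (𝓝[<] M) (𝓝 m)) (hY : Tendsto Y (𝓝[<] M) (𝓝 0)) :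
    Tendsto (branchPohozaev k f F σ R Y) (𝓝[<] M) (𝓝 (m ^ (k + 2) * (2 * F M))) := by
  obtain ⟨h, hh, -⟩ := hA.pohozaev M hM
  have hH : Tendsto (fun s => F s / f s) (𝓝[<] M) (𝓝 (F M / f M)) :=
    hh.continuousAt.mono_left nhdsWithin_le_nhds
  have hF : Tendsto F (𝓝[<] M) (𝓝 (F M)) :=
    (hA.hasDerivAt M (by linarith)).continuousAt.mono_left nhdsWithin_le_nhds
  have := ((hR.pow (k + 2)).mul ((hY.pow 2).add (hF.const_mul 2))).add
    (((tendsto_flux_max k hR hY).const_mul (σ * (2 * (k + 2)))).mul hH)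
  simp only [zero_pow two_ne_zero, zero_add, mul_zero, zero_mul, add_zero] at this
  exact this

theorem IsBranch.hasDerivAt_pohozaev_of_admissible (hA : IsAdmissible k f F β)
    (hb : IsBranch k f σ M R Y) {h : ℝ → ℝ}
    (hh : ∀ s, 1 < s → HasDerivAt (fun s => F s / f s) (h s) s ∧ (k : ℝ) ≤ 2 * (k + 2) * h s)
    (hs : 1 < s) (hsM : s < M) :
    HasDerivAt (branchPohozaev k f F σ R Y)
      (σ * ((2 * (k + 2) * h s - k) * branchFlux k R Y s)) s :=
  hb.hasDerivAt_pohozaev (hA.hasDerivAt s (by linarith)) (hA.f_pos s hs).ne' (hh s hs).1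
    ⟨by linarith, hsM⟩

theorem down_pohozaev_pos (hA : IsAdmissible k f F β) (hb : IsBranch k f (-1) M R Y)
    (hM : β < M) (hm : 0 < m)
    (hR : Tendsto R (𝓝[<] M) (𝓝 m)) (hY : Tendsto Y (𝓝[<] M) (𝓝 0)) (hs : 1 < s) (hsM : s < M) :
    0 < branchPohozaev k f F (-1) R Y s := by
  choose! h hh using hA.pohozaev
  have hlim := hA.tendsto_pohozaev_max (hA.one_lt.trans hM) (-1) hR hY
  have := limit_le_of_hasDerivAt_nonpos hlim
    (fun t ht => hb.hasDerivAt_pohozaev_of_admissible hA hh (hs.trans_le ht.1) ht.2)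
    (fun t ht => by
      have ht1 := hs.trans ht.1
      have h1 := (hh t ht1).2
      have h2 := hb.flux_pos (s := t) ⟨by linarith, ht.2⟩
      nlinarith) hsM
  have hF := hA.F_pos M hM
  exact lt_of_lt_of_le (by positivity) this

/-- The gap is 0 at the peak. Its derivative is a nonpositive multiple of the sum of the two fluxes,
so it grows as the value decreases. -/
theorem IsBump.pohozaev_gap_nonneg (hA : IsAdmissible k f F β)
    (hb : IsBump k f F a M m α R Y R' Y') (hs : 1 < s) (hsM : s < M) :
    0 ≤ branchPohozaev k f F (-1) R' Y' s - branchPohozaev k f F 1 R Y s := by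
  choose! h hh using hA.pohozaev
  have hM := hs.trans hsM
  have hlim := (hA.tendsto_pohozaev_max hM (-1) hb.tendsto_R'_max hb.tendsto_Y'_max).sub
    (hA.tendsto_pohozaev_max hM 1 hb.tendsto_R_max hb.tendsto_Y_max)
  rw [sub_self] at hlim
  exact limit_le_of_hasDerivAt_nonpos (φ := fun s => branchPohozaev k f F (-1) R' Y' s -
    branchPohozaev k f F 1 R Y s) hlim
    (fun t ht =>
      (hb.down.hasDerivAt_pohozaev_of_admissible hA hh (hs.trans_le ht.1) ht.2).sub
      (hb.up.hasDerivAt_pohozaev_of_admissible hA hh (hs.trans_le ht.1) ht.2))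
    (fun t ht => by
      have ht1 := hs.trans ht.1
      have h1 := (hh t ht1).2
      have h2 := hb.down.flux_pos (s := t) ⟨by linarith, ht.2⟩
      have h3 := hb.up.flux_pos (s := t) ⟨by linarith, ht.2⟩
      nlinarith) hsM

end Peak

/-! ### Comparison of the decreasing branches above β -/

section Comparison

variable {k : ℕ} {f F : ℝ → ℝ} {β a M₁ M₂ m₁ m₂ α₁ α₂ s c : ℝ}
  {R₁ Y₁ R₁' Y₁' R₂ Y₂ R₂' Y₂' : ℝ → ℝ}

/-- The excess of the Pohozaev functional gained across the peak. -/
theorem down_pohozaev_lt (hA : IsAdmissible k f F β)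
    (hu : IsBump k f F a M₁ m₁ α₁ R₁ Y₁ R₁' Y₁') (hv : IsBump k f F a M₂ m₂ α₂ R₂ Y₂ R₂' Y₂')
    (hM : M₁ < M₂) (hs : 1 < s) (hsM : s < M₁)
    (hup : ∀ t ∈ Ico s M₁, branchFlux k R₁ Y₁ t ≤ branchFlux k R₂ Y₂ t)
    (hdown : ∀ t ∈ Ioo s M₁, branchFlux k R₁' Y₁' t ≤ branchFlux k R₂' Y₂' t)
    (hP : branchPohozaev k f F 1 R₁ Y₁ s < branchPohozaev k f F 1 R₂ Y₂ s) :
    branchPohozaev k f F (-1) R₁' Y₁' s < branchPohozaev k f F (-1) R₂' Y₂' s := by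
  -- At M₁ the gap between the two branches of the second bump is nonnegative, while that of the
  -- first tends to 0. Below M₁ the larger fluxes make the second gap grow at least as fast.
  have hgap := hv.pohozaev_gap_nonneg hA (hs.trans hsM) hM
  choose! h hh using hA.pohozaev
  have hM1 := hs.trans hsM
  have hlim₁ := (hA.tendsto_pohozaev_max hM1 (-1) hu.tendsto_R'_max hu.tendsto_Y'_max).sub
    (hA.tendsto_pohozaev_max hM1 1 hu.tendsto_R_max hu.tendsto_Y_max)
  have hc₂ := ((hv.down.hasDerivAt_pohozaev_of_admissible hA hh hM1 hM).sub
    (hv.up.hasDerivAt_pohozaev_of_admissible hA hh hM1 hM)).continuousAt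
  have hlim₂ : Tendsto (fun s => branchPohozaev k f F (-1) R₂' Y₂' s -
      branchPohozaev k f F 1 R₂ Y₂ s) (𝓝[<] M₁) (𝓝 (branchPohozaev k f F (-1) R₂' Y₂' M₁ -
      branchPohozaev k f F 1 R₂ Y₂ M₁)) := hc₂.mono_left nhdsWithin_le_nhds
  have hlim := hlim₂.sub hlim₁
  rw [sub_self, sub_zero] at hlim
  have := limit_le_of_hasDerivAt_nonpos hlim
    (fun t ht =>
      ((hv.down.hasDerivAt_pohozaev_of_admissible hA hh (hs.trans_le ht.1) (ht.2.trans hM)).sub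
      (hv.up.hasDerivAt_pohozaev_of_admissible hA hh (hs.trans_le ht.1) (ht.2.trans hM))).sub
      ((hu.down.hasDerivAt_pohozaev_of_admissible hA hh (hs.trans_le ht.1) ht.2).sub
      (hu.up.hasDerivAt_pohozaev_of_admissible hA hh (hs.trans_le ht.1) ht.2)))
    (fun t ht => by
      have h1 := (hh t (hs.trans ht.1)).2
      have h2 := hup t ⟨ht.1.le, ht.2⟩
      have h3 := hdown t ht
      nlinarith) hsM
  linarith

/-- The Erbe–Tang ratio functional `P₂ - (Q₂ / Q₁) P₁` decreases as long as the second branch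
is steeper. -/
theorem down_ratio_pohozaev_le (hA : IsAdmissible k f F β) {s₁ : ℝ}
    (hu : IsBranch k f (-1) M₁ R₁ Y₁) (hv : IsBranch k f (-1) M₂ R₂ Y₂)
    (hs : 1 < s) (hss : s ≤ s₁) (hs₁ : s₁ < M₁) (hs₂ : s₁ < M₂)
    (hP : ∀ t ∈ Ioo s s₁, 0 < branchPohozaev k f F (-1) R₁ Y₁ t)
    (hY : ∀ t ∈ Ioo s s₁, Y₁ t < Y₂ t) :
    branchPohozaev k f F (-1) R₂ Y₂ s₁ -
        branchFlux k R₂ Y₂ s₁ / branchFlux k R₁ Y₁ s₁ * branchPohozaev k f F (-1) R₁ Y₁ s₁ ≤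
      branchPohozaev k f F (-1) R₂ Y₂ s -
        branchFlux k R₂ Y₂ s / branchFlux k R₁ Y₁ s * branchPohozaev k f F (-1) R₁ Y₁ s := by
  choose! h hh using hA.pohozaev
  -- The terms with (F/f)' cancel, since P₁' and P₂' are proportional to Q₁ and Q₂ with the same
  -- factor. Only the derivative of Q₂/Q₁ remains.
  refine le_of_hasDerivAt_nonpos (φ := fun s => branchPohozaev k f F (-1) R₂ Y₂ s -
    branchFlux k R₂ Y₂ s / branchFlux k R₁ Y₁ s * branchPohozaev k f F (-1) R₁ Y₁ s)
    (φ' := fun t => -(branchFlux k R₂ Y₂ t / branchFlux k R₁ Y₁ t *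
      (f t * (1 / Y₁ t ^ 2 - 1 / Y₂ t ^ 2)) * branchPohozaev k f F (-1) R₁ Y₁ t)) hss
    (fun t ht => ?_) (fun t ht => ?_)
  · have ht1 : 1 < t := hs.trans_le ht.1
    have ht₁ : t ∈ Ioo 0 M₁ := ⟨by linarith, ht.2.trans_lt hs₁⟩
    have ht₂ : t ∈ Ioo 0 M₂ := ⟨by linarith, ht.2.trans_lt hs₂⟩
    have hq := (hu.flux_pos ht₁).ne'
    refine ((hv.hasDerivAt_pohozaev_of_admissible hA hh ht1 ht₂.2).sub
      (((hv.hasDerivAt_flux ht₂).div (hu.hasDerivAt_flux ht₁) hq).mul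
      (hu.hasDerivAt_pohozaev_of_admissible hA hh ht1 ht₁.2))).congr_deriv ?_
    have hR₁ := (hu.R_pos t ht₁).ne'
    have hY₁ := (hu.Y_pos t ht₁).ne'
    have hY₂ := (hv.Y_pos t ht₂).ne'
    have hR₂ := (hv.R_pos t ht₂).ne'
    generalize branchPohozaev k f F (-1) R₁ Y₁ t = p
    simp only [branchFlux, Pi.div_apply]
    field_simp
    ring
  · have ht1 : 1 < t := hs.trans ht.1
    have hq₁ := hu.flux_pos (s := t) ⟨by linarith, ht.2.trans hs₁⟩
    have hq₂ := hv.flux_pos (s := t) ⟨by linarith, ht.2.trans hs₂⟩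
    have hy₁ := hu.Y_pos t ⟨by linarith, ht.2.trans hs₁⟩
    have hy := hY t ht
    have hf := hA.f_pos t ht1
    have hp := hP t ht
    have : 0 ≤ 1 / Y₁ t ^ 2 - 1 / Y₂ t ^ 2 := by
      rw [sub_nonneg]
      gcongr
    rw [neg_nonpos]
    positivity

/-- The F/f terms drop out because Q₂ - (Q₂/Q₁)Q₁ = 0. -/
theorem ratio_pohozaev_eq {R₁ Y₁ R₂ Y₂ : ℝ → ℝ} (hq : branchFlux k R₁ Y₁ s ≠ 0) :
    branchPohozaev k f F (-1) R₂ Y₂ s -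
        branchFlux k R₂ Y₂ s / branchFlux k R₁ Y₁ s * branchPohozaev k f F (-1) R₁ Y₁ s =
      R₂ s ^ (k + 2) * branchEnergy F Y₂ s -
        branchFlux k R₂ Y₂ s / branchFlux k R₁ Y₁ s * (R₁ s ^ (k + 2) * branchEnergy F Y₁ s) := by
  simp only [branchPohozaev]
  field_simp
  ring

/-- Below a value `c` where the radius of the decreasing second branch is at most that of the
first one, either the fluxes stay ordered or the ratio functional is positive. -/
theorem down_flux_lt_or_ratio_pos (hA : IsAdmissible k f F β)
    (hu : IsBump k f F a M₁ m₁ α₁ R₁ Y₁ R₁' Y₁') (hv : IsBump k f F a M₂ m₂ α₂ R₂ Y₂ R₂' Y₂')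
    (hM : M₁ < M₂) (hcM : c ≤ M₁)
    (hup : ∀ t ∈ Ico β M₁, branchFlux k R₁ Y₁ t < branchFlux k R₂ Y₂ t)
    (hP : ∀ t ∈ Ico β M₁, branchPohozaev k f F 1 R₁ Y₁ t < branchPohozaev k f F 1 R₂ Y₂ t)
    (hdown : ∀ t ∈ Ico c M₁, branchFlux k R₁' Y₁' t ≤ branchFlux k R₂' Y₂' t)
    (hQc : ∀ᶠ t in 𝓝[<] c, branchFlux k R₁' Y₁' t < branchFlux k R₂' Y₂' t)
    (hs : β ≤ s) (hsc : s < c) (hY : ∀ t ∈ Ioo s c, Y₁' t < Y₂' t) :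
    branchFlux k R₁' Y₁' s < branchFlux k R₂' Y₂' s ∨
      R₁' s * branchEnergy F Y₁' s * Y₂' s < R₂' s * branchEnergy F Y₂' s * Y₁' s := by
  by_cases hq : branchFlux k R₁' Y₁' s < branchFlux k R₂' Y₂' s
  · exact Or.inl hq
  right
  have hβ := hA.one_lt
  have hs1 : 1 < s := hβ.trans_le hs
  -- At the highest value s₁ below c where the fluxes agree, the ratio functional equals P₂ - P₁ >
  -- 0. It cannot decrease on the way down to s.
  obtain ⟨s₁, hs₁, hs₁0, hs₁pos⟩ := exists_last_zero
    (φ := fun t => branchFlux k R₂' Y₂' t - branchFlux k R₁' Y₁' t) (a := s) (b := c)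
    (fun t ht => by
      have ht0 : 0 < t := by linarith [ht.1]
      exact ((hv.down.hasDerivAt_flux ⟨ht0, ht.2.trans (hcM.trans_lt hM)⟩).sub
        (hu.down.hasDerivAt_flux ⟨ht0, ht.2.trans_le hcM⟩)).continuousAt.continuousWithinAt)
    (hQc.mono fun t ht => sub_pos.2 ht) ⟨s, ⟨le_rfl, hsc⟩, by linarith⟩
  have hs₁M := hs₁.2.trans_le hcM
  have hs₁1 : 1 < s₁ := hs1.trans_le hs₁.1
  have hpoh := down_pohozaev_lt hA hu hv hM hs₁1 hs₁M
    (fun t ht => (hup t ⟨hs.trans (hs₁.1.trans ht.1), ht.2⟩).le)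
    (fun t ht => by
      rcases lt_or_ge t c with htc | htc
      · exact (sub_pos.1 (hs₁pos t ⟨ht.1, htc⟩)).le
      · exact hdown t ⟨htc, ht.2⟩)
    (hP s₁ ⟨hs.trans hs₁.1, hs₁M⟩)
  have hpos : ∀ t ∈ Ioo s s₁, 0 < branchPohozaev k f F (-1) R₁' Y₁' t := fun t ht =>
    down_pohozaev_pos hA hu.down ((hs.trans_lt hsc).trans_le hcM) hu.peak_pos hu.tendsto_R'_max
      hu.tendsto_Y'_max (hs1.trans ht.1) (ht.2.trans hs₁M)
  have hT := down_ratio_pohozaev_le hA hu.down hv.down hs1 hs₁.1 hs₁M (hs₁M.trans hM) hpos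
    (fun t ht => hY t ⟨ht.1, ht.2.trans hs₁.2⟩)
  have hs₁I : s₁ ∈ Ioo 0 M₁ := ⟨by linarith, hs₁M⟩
  have hsI : s ∈ Ioo 0 M₁ := ⟨by linarith, hsc.trans_le hcM⟩
  have hsI₂ : s ∈ Ioo 0 M₂ := ⟨hsI.1, hsI.2.trans hM⟩
  rw [sub_eq_zero.1 hs₁0, div_self (hu.down.flux_pos hs₁I).ne', one_mul,
    ratio_pohozaev_eq (hu.down.flux_pos hsI).ne'] at hT
  have hR₁ := hu.down.R_pos s hsI
  have hR₂ := hv.down.R_pos s hsI₂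
  have hY₁ := hu.down.Y_pos s hsI
  have hpos : 0 < R₂' s ^ (k + 2) * branchEnergy F Y₂' s -
      branchFlux k R₂' Y₂' s / branchFlux k R₁' Y₁' s *
        (R₁' s ^ (k + 2) * branchEnergy F Y₁' s) := by linarith
  have he : R₂' s ^ (k + 2) * branchEnergy F Y₂' s -
      branchFlux k R₂' Y₂' s / branchFlux k R₁' Y₁' s *
        (R₁' s ^ (k + 2) * branchEnergy F Y₁' s) =
      R₂' s ^ (k + 1) / Y₁' s * (R₂' s * branchEnergy F Y₂' s * Y₁' s -
        R₁' s * branchEnergy F Y₁' s * Y₂' s) := by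
    simp only [branchFlux]
    field_simp
    ring
  rw [he] at hpos
  have := pos_of_mul_pos_right hpos (by positivity)
  linarith

/-- This carries the comparison from c down to β, where `down_separation` takes over. The second
branch stays ahead and steeper, and at β, where F = 0, the virial is R·Y. -/
theorem down_virial_lt (hA : IsAdmissible k f F β)
    (hu : IsBump k f F a M₁ m₁ α₁ R₁ Y₁ R₁' Y₁') (hv : IsBump k f F a M₂ m₂ α₂ R₂ Y₂ R₂' Y₂')
    (hM : M₁ < M₂) (hβc : β < c) (hcM : c ≤ M₁)
    (hup : ∀ t ∈ Ico β M₁, branchFlux k R₁ Y₁ t < branchFlux k R₂ Y₂ t)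
    (hP : ∀ t ∈ Ico β M₁, branchPohozaev k f F 1 R₁ Y₁ t < branchPohozaev k f F 1 R₂ Y₂ t)
    (hdown : ∀ t ∈ Ico c M₁, branchFlux k R₁' Y₁' t ≤ branchFlux k R₂' Y₂' t)
    (hQc : ∀ᶠ t in 𝓝[<] c, branchFlux k R₁' Y₁' t < branchFlux k R₂' Y₂' t)
    (hYc : ∀ᶠ t in 𝓝[<] c, Y₁' t < Y₂' t) {ρ : ℝ} (hρ : 0 ≤ ρ)
    (hRc : Tendsto (fun t => R₁' t - R₂' t) (𝓝[<] c) (𝓝 ρ)) :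
    R₂' β < R₁' β ∧ R₁' β * √(branchEnergy F Y₁' β) < R₂' β * √(branchEnergy F Y₂' β) := by
  have hβ := hA.one_lt
  have mem₁ : ∀ t, β ≤ t → t < c → t ∈ Ioo 0 M₁ :=
    fun t h1 h2 => ⟨by linarith, h2.trans_le hcM⟩
  have mem₂ : ∀ t, β ≤ t → t < c → t ∈ Ioo 0 M₂ :=
    fun t h1 h2 => ⟨by linarith, h2.trans_le (hcM.trans hM.le)⟩
  have hR : ∀ s, β ≤ s → s < c → (∀ t ∈ Ioo s c, Y₁' t < Y₂' t) → R₂' s < R₁' s := by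
    intro s hs hsc hY
    have := limit_lt_of_hasDerivAt_neg hRc
      (fun t ht => (hu.down.hasDerivAt_R t (mem₁ t (hs.trans ht.1) ht.2)).sub
        (hv.down.hasDerivAt_R t (mem₂ t (hs.trans ht.1) ht.2)))
      (fun t ht => by
        have := one_div_lt_one_div_of_lt (hu.down.Y_pos t (mem₁ t (hs.trans ht.1.le) ht.2))
          (hY t ht)
        rw [neg_div, neg_div]
        linarith) hsc
    linarith
  have hY : ∀ s ∈ Ico β c, 0 < Y₂' s - Y₁' s := by
    refine pos_of_no_last_zero (fun t ht => ((hv.down.hasDerivAt_Y t (mem₂ t ht.1 ht.2)).sub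
      (hu.down.hasDerivAt_Y t (mem₁ t ht.1 ht.2))).continuousAt.continuousWithinAt)
      (hYc.mono fun t ht => sub_pos.2 ht) fun s hs h heq => ?_
    have h' : ∀ t ∈ Ioo s c, Y₁' t < Y₂' t := fun t ht => sub_pos.1 (h t ht)
    have heq' : Y₂' s = Y₁' s := sub_eq_zero.1 heq
    have hRs := hR s hs.1 hs.2 h'
    have hr₂ := hv.down.R_pos s (mem₂ s hs.1 hs.2)
    have hy := hu.down.Y_pos s (mem₁ s hs.1 hs.2)
    have he := hu.energy_down s (mem₁ s hs.1 hs.2)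
    -- With equal slopes, each alternative would make the second radius the larger one.
    rcases down_flux_lt_or_ratio_pos hA hu hv hM hcM hup hP hdown hQc hs.1 hs.2 h' with hq | hq
    · simp only [branchFlux, heq'] at hq
      have : R₂' s ^ (k + 1) ≤ R₁' s ^ (k + 1) := by gcongr
      nlinarith
    · simp only [branchEnergy, heq'] at hq he
      have := lt_of_mul_lt_mul_right hq hy.le
      have := lt_of_mul_lt_mul_right this he.le
      linarith
  have hRβ := hR β le_rfl hβc fun t ht => sub_pos.1 (hY t ⟨ht.1.le, ht.2⟩)
  refine ⟨hRβ, ?_⟩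
  have hr₂ := hv.down.R_pos β (mem₂ β le_rfl hβc)
  have hr₁ := hu.down.R_pos β (mem₁ β le_rfl hβc)
  have hy₁ := hu.down.Y_pos β (mem₁ β le_rfl hβc)
  have hy₂ := hv.down.Y_pos β (mem₂ β le_rfl hβc)
  simp only [branchEnergy, hA.F_eq_zero, mul_zero, add_zero, Real.sqrt_sq hy₁.le,
    Real.sqrt_sq hy₂.le]
  rcases down_flux_lt_or_ratio_pos hA hu hv hM hcM hup hP hdown hQc le_rfl hβc
    (fun t ht => sub_pos.1 (hY t ⟨ht.1.le, ht.2⟩)) with hq | hq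
  · simp only [branchFlux, pow_succ, mul_assoc] at hq
    have h1 : R₂' β ^ k * (R₂' β * Y₂' β) ≤ R₁' β ^ k * (R₂' β * Y₂' β) := by gcongr
    exact lt_of_mul_lt_mul_left (hq.trans_le h1) (by positivity)
  · simp only [branchEnergy, hA.F_eq_zero, mul_zero, add_zero] at hq
    have : R₁' β * Y₁' β * (Y₁' β * Y₂' β) < R₂' β * Y₂' β * (Y₁' β * Y₂' β) := by linarith
    exact lt_of_mul_lt_mul_right this (by positivity)

/-- Comparison of two bumps issuing from the same radius with different slopes: if the decreasing
branches cross above the value `1`, then the radii where they take small values differ. -/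
theorem IsBump.separation (hA : IsAdmissible k f F β) (ha : 0 < a)
    (hu : IsBump k f F a M₁ m₁ α₁ R₁ Y₁ R₁' Y₁') (hv : IsBump k f F a M₂ m₂ α₂ R₂ Y₂ R₂' Y₂')
    (hM₁ : β < M₁) (hM₂ : β < M₂) (hα : α₁ < α₂)
    (hcross : M₁ < M₂ → (∀ s ∈ Ico 1 M₁, R₂ s < R₁ s) → ¬ ∀ s ∈ Ico 1 M₁, R₁' s < R₂' s) :
    ∃ c > 0, ∃ s₁ > 0, s₁ < M₁ ∧ s₁ < M₂ ∧
      ∀ s ∈ Ioo 0 s₁, R₂' s + c ≤ R₁' s ∧ c ≤ R₂' s * Y₂' s := by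
  have hβ := hA.one_lt
  have hM := hu.max_lt_max hA ha hv hα hM₂
  have hYup : ∀ t, 0 < t → t < M₁ → Y₁ t < Y₂ t := fun t h0 h1 =>
    up_slope_lt hA ha hu.slope_pos hα hu.up hv.up hu.energy_up hu.tendsto_R_zero hv.tendsto_R_zero
      hu.tendsto_Y_zero hv.tendsto_Y_zero h0 h1 (h1.trans hM)
  have hRup : ∀ t, 0 < t → t < M₁ → R₂ t < R₁ t := fun t h0 h1 =>
    up_radius_lt hu.up hv.up hu.tendsto_R_zero hv.tendsto_R_zero h0 h1 (h1.trans hM)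
      (fun x hx => hYup x hx.1 (hx.2.trans h1))
  have hup : ∀ t ∈ Ico β M₁, branchFlux k R₁ Y₁ t < branchFlux k R₂ Y₂ t := fun t ht =>
    up_flux_lt hA ha hu.slope_pos hα hu.up hv.up hu.tendsto_R_zero hv.tendsto_R_zero
      hu.tendsto_Y_zero hv.tendsto_Y_zero ht.1 ht.2 (ht.2.trans hM)
      (fun x hx => hYup x hx.1 (hx.2.trans ht.2))
  have hP : ∀ t ∈ Ico β M₁, branchPohozaev k f F 1 R₁ Y₁ t < branchPohozaev k f F 1 R₂ Y₂ t :=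
    fun t ht => up_pohozaev_lt hA hu.up hv.up ht.1 ht.2 (ht.2.trans hM)
      (hRup β (by linarith) hM₁) (fun x hx => hup x ⟨hx.1, hx.2.trans_lt ht.2⟩)
  have hM₁0 : M₁ ∈ Ioo 0 M₂ := ⟨by linarith, hM⟩
  have hQ₂M := hv.down.flux_pos hM₁0
  have hcR₂ : Tendsto R₂' (𝓝[<] M₁) (𝓝 (R₂' M₁)) :=
    (hv.down.hasDerivAt_R M₁ hM₁0).continuousAt.mono_left nhdsWithin_le_nhds
  have hcY₂ : Tendsto Y₂' (𝓝[<] M₁) (𝓝 (Y₂' M₁)) :=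
    (hv.down.hasDerivAt_Y M₁ hM₁0).continuousAt.mono_left nhdsWithin_le_nhds
  have hcQ₂ : Tendsto (branchFlux k R₂' Y₂') (𝓝[<] M₁) (𝓝 (branchFlux k R₂' Y₂' M₁)) :=
    (hv.down.hasDerivAt_flux hM₁0).continuousAt.mono_left nhdsWithin_le_nhds
  have hcQ₁ := tendsto_flux_max k hu.tendsto_R'_max hu.tendsto_Y'_max
  -- Either the second solution is back at height M₁ no later than the first one peaks, and the
  -- comparison starts at c = M₁; or it starts at the highest crossing c, which exists by `hcross`.
  rcases le_or_gt (R₂' M₁) m₁ with hm | hm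
  · have hYc : ∀ᶠ t in 𝓝[<] M₁, Y₁' t < Y₂' t :=
      (hu.tendsto_Y'_max).eventually_lt hcY₂ (hv.down.Y_pos M₁ hM₁0)
    have hQc : ∀ᶠ t in 𝓝[<] M₁, branchFlux k R₁' Y₁' t < branchFlux k R₂' Y₂' t :=
      hcQ₁.eventually_lt hcQ₂ hQ₂M
    have := down_virial_lt hA hu hv hM hM₁ le_rfl hup hP
      (fun t ht => absurd ht.1 (not_le.2 ht.2)) hQc hYc (sub_nonneg.2 hm)
      (hu.tendsto_R'_max.sub hcR₂)
    exact down_separation hA hu.down hv.down hu.energy_down hv.energy_down (by linarith) le_rfl hM₁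
      hM₂ this.1.le this.2
  · have hnc := hcross hM (fun s hs => hRup s (by linarith [hs.1]) hs.2)
    push Not at hnc
    obtain ⟨x, hx, hx'⟩ := hnc
    obtain ⟨c, hc, hc0, hcpos⟩ := exists_last_zero (φ := fun t => R₂' t - R₁' t) (a := 1) (b := M₁)
      (fun t ht => ((hv.down.hasDerivAt_R t ⟨by linarith [ht.1], ht.2.trans hM⟩).sub
        (hu.down.hasDerivAt_R t ⟨by linarith [ht.1], ht.2⟩)).continuousAt.continuousWithinAt)
      ((hu.tendsto_R'_max.eventually_lt hcR₂ hm).mono fun t ht => sub_pos.2 ht)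
      ⟨x, hx, by linarith⟩
    have hc0' : R₂' c = R₁' c := sub_eq_zero.1 hc0
    have hc1 : c ∈ Ioo 0 M₁ := ⟨by linarith [hc.1], hc.2⟩
    have hc2 : c ∈ Ioo 0 M₂ := ⟨by linarith [hc.1], hc.2.trans hM⟩
    -- Between c and M₁ the second radius is larger and f > 0, so Q₂² - Q₁² increases on the way
    -- down, starting from the positive limit Q₂(M₁)².
    have hQ : ∀ t ∈ Ico c M₁, branchFlux k R₁' Y₁' t < branchFlux k R₂' Y₂' t := by
      intro t ht
      have hlim := (hcQ₂.pow 2).sub (hcQ₁.pow 2)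
      have h1 := limit_le_of_hasDerivAt_nonpos hlim
        (fun x hx => by
          have hx0 : 0 < x := by linarith [hc1.1, ht.1, hx.1]
          exact (hv.down.hasDerivAt_flux_sq ⟨hx0, hx.2.trans hM⟩).sub
            (hu.down.hasDerivAt_flux_sq ⟨hx0, hx.2⟩))
        (fun x hx => by
          have hxc : c < x := ht.1.trans_lt hx.1
          have hf := hA.f_pos x (hc.1.trans_lt hxc)
          have hr₁ := hu.down.R_pos x ⟨hc1.1.trans hxc, hx.2⟩
          have hr := sub_pos.1 (hcpos x ⟨hxc, hx.2⟩)
          have h1 : (R₁' x ^ (k + 1)) ^ 2 ≤ (R₂' x ^ (k + 1)) ^ 2 := by gcongr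
          nlinarith) ht.2
      have h2 : 0 < branchFlux k R₂' Y₂' M₁ ^ 2 - 0 ^ 2 := by
        rw [zero_pow two_ne_zero, sub_zero]
        positivity
      have h3 := hv.down.flux_pos (s := t) ⟨hc1.1.trans_le ht.1, ht.2.trans hM⟩
      exact lt_of_pow_lt_pow_left₀ 2 h3.le (by linarith)
    have hYc : Y₁' c < Y₂' c := by
      have := hQ c ⟨le_rfl, hc.2⟩
      simp only [branchFlux, hc0'] at this
      exact lt_of_mul_lt_mul_left this (pow_pos (hu.down.R_pos c hc1) _).le
    rcases le_or_gt c β with hcβ | hcβ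
    · refine down_separation hA hu.down hv.down hu.energy_down hv.energy_down hc1.1 hcβ hc1.2
        hc2.2 hc0'.le ?_
      rw [hc0']
      have hy := hu.down.Y_pos c hc1
      have : branchEnergy F Y₁' c < branchEnergy F Y₂' c := by
        simp only [branchEnergy]
        gcongr
      have h2 := Real.sqrt_lt_sqrt (hu.energy_down c hc1).le this
      have h3 := hu.down.R_pos c hc1
      gcongr
    · have dY₁ := (hu.down.hasDerivAt_Y c hc1).continuousAt.tendsto.mono_left
        (nhdsWithin_le_nhds (s := Iio c))
      have dY₂ := (hv.down.hasDerivAt_Y c hc2).continuousAt.tendsto.mono_left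
        (nhdsWithin_le_nhds (s := Iio c))
      have dQ₁ := (hu.down.hasDerivAt_flux hc1).continuousAt.tendsto.mono_left
        (nhdsWithin_le_nhds (s := Iio c))
      have dQ₂ := (hv.down.hasDerivAt_flux hc2).continuousAt.tendsto.mono_left
        (nhdsWithin_le_nhds (s := Iio c))
      have dR₁ := (hu.down.hasDerivAt_R c hc1).continuousAt.tendsto.mono_left
        (nhdsWithin_le_nhds (s := Iio c))
      have dR₂ := (hv.down.hasDerivAt_R c hc2).continuousAt.tendsto.mono_left
        (nhdsWithin_le_nhds (s := Iio c))
      have := down_virial_lt hA hu hv hM hcβ hc.2.le hup hP (fun t ht => (hQ t ht).le)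
        (dQ₁.eventually_lt dQ₂ (hQ c ⟨le_rfl, hc.2⟩)) (dY₁.eventually_lt dY₂ hYc)
        (sub_nonneg.2 hc0'.le) (dR₁.sub dR₂)
      exact down_separation hA hu.down hv.down hu.energy_down hv.energy_down (by linarith) le_rfl
        hM₁ hM₂ this.1.le this.2

end Comparison

/-! ### Qualitative behaviour of positive radial solutions -/

/-- A positive radial solution `u` in dimension `k + 2`, with derivative `w`, on an interval `I`
with left end point `a`, vanishing at both ends of `I`. -/
structure IsPositiveRadial (k : ℕ) (f : ℝ → ℝ) (a : ℝ) (I : Set ℝ) (u w : ℝ → ℝ) : Prop where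
  a_pos : 0 < a
  nonempty : I.Nonempty
  lt_of_mem : ∀ r ∈ I, a < r
  left_subset : ∀ r ∈ I, Ioc a r ⊆ I
  exists_gt : ∀ r ∈ I, ∃ r' ∈ I, r < r'
  hasDerivAt_u : ∀ r ∈ I, HasDerivAt u (w r) r
  hasDerivAt_w : ∀ r ∈ I, HasDerivAt w (-((k + 1) / r * w r) - f (u r)) r
  pos : ∀ r ∈ I, 0 < u r
  left : Tendsto u (𝓝[>] a) (𝓝 0)
  right : ∀ ε > 0, ∃ r₀ ∈ I, ∀ r ∈ I, r₀ < r → u r < ε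

/-- The relation between a positive radial solution and the branches of its bump. -/
structure IsBumpOf (a : ℝ) (I : Set ℝ) (u w : ℝ → ℝ) (M m : ℝ) (R Y R' Y' : ℝ → ℝ) : Prop where
  peak_mem : m ∈ I
  u_peak : u m = M
  slope_up : ∀ r ∈ I, r < m → 0 < w r
  slope_down : ∀ r ∈ I, m < r → w r < 0
  R_mem : ∀ s ∈ Ioo 0 M, R s ∈ Ioo a m
  u_R : ∀ s ∈ Ioo 0 M, u (R s) = s
  Y_eq : ∀ s ∈ Ioo 0 M, Y s = w (R s)
  R'_mem : ∀ s ∈ Ioo 0 M, R' s ∈ I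
  lt_R' : ∀ s ∈ Ioo 0 M, m < R' s
  u_R' : ∀ s ∈ Ioo 0 M, u (R' s) = s
  Y'_eq : ∀ s ∈ Ioo 0 M, Y' s = -w (R' s)

/-- The radius is a local inverse of u. Since w is continuous, u is strictly differentiable, and the
inverse function rule gives R' = 1/w. -/
theorem exists_isBranch {k : ℕ} {f : ℝ → ℝ} {σ M : ℝ} {J : Set ℝ} {u w : ℝ → ℝ}
    (hσ : σ ^ 2 = 1) (hJ : ∀ r ∈ J, J ∈ 𝓝 r) (hpos : ∀ r ∈ J, 0 < r)
    (hu : ∀ r ∈ J, HasDerivAt u (w r) r)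
    (hw : ∀ r ∈ J, HasDerivAt w (-((k + 1) / r * w r) - f (u r)) r)
    (hσw : ∀ r ∈ J, 0 < σ * w r) (hinj : InjOn u J) (hsurj : SurjOn u J (Ioo 0 M)) :
    ∃ R : ℝ → ℝ, (∀ s ∈ Ioo 0 M, R s ∈ J ∧ u (R s) = s) ∧
      IsBranch k f σ M R (fun s => σ * w (R s)) := by
  have hR : ∀ s ∈ Ioo 0 M, Function.invFunOn u J s ∈ J ∧ u (Function.invFunOn u J s) = s :=
    fun s hs => ⟨Function.invFunOn_mem (hsurj hs), Function.invFunOn_eq (hsurj hs)⟩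
  set R := Function.invFunOn u J
  have hRd : ∀ s ∈ Ioo 0 M, HasDerivAt R (w (R s))⁻¹ s := by
    intro s hs
    obtain ⟨hmem, heq⟩ := hR s hs
    have hstrict : HasStrictDerivAt u (w (R s)) (R s) :=
      hasStrictDerivAt_of_hasDerivAt_of_continuousAt
        (by filter_upwards [hJ _ hmem] with y hy using hu y hy) (hw _ hmem).continuousAt
    have hne : w (R s) ≠ 0 := fun h => by
      have := hσw _ hmem
      rw [h, mul_zero] at this
      exact lt_irrefl _ this
    have := hstrict.to_local_left_inverse (g := R) hne (by
      filter_upwards [hJ _ hmem] with y hy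
      exact hinj.leftInvOn_invFunOn hy)
    rw [heq] at this
    exact this.hasDerivAt
  refine ⟨R, hR, fun s hs => hpos _ (hR s hs).1, fun s hs => hσw _ (hR s hs).1, fun s hs => ?_,
    fun s hs => ?_⟩
  · have h0 := (hσw _ (hR s hs).1).ne'
    refine (hRd s hs).congr_deriv ?_
    have h1 := left_ne_zero_of_mul h0
    have h2 := right_ne_zero_of_mul h0
    field_simp
  · have h0 := (hσw _ (hR s hs).1).ne'
    have h1 := left_ne_zero_of_mul h0
    have h2 := right_ne_zero_of_mul h0
    have h3 := (hpos _ (hR s hs).1).ne'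
    refine (((hw _ (hR s hs).1).comp s (hRd s hs)).const_mul σ).congr_deriv ?_
    rw [(hR s hs).2]
    field_simp
    linear_combination (-(R s * f s)) * hσ

namespace IsPositiveRadial

variable {k : ℕ} {f F : ℝ → ℝ} {β a : ℝ} {I : Set ℝ} {u w : ℝ → ℝ}

theorem Icc_subset (hu : IsPositiveRadial k f a I u w) {x y : ℝ} (hx : x ∈ I) (hy : y ∈ I) :
    Icc x y ⊆ I :=
  fun _ hz => hu.left_subset y hy ⟨(hu.lt_of_mem x hx).trans_le hz.1, hz.2⟩

theorem mem_nhds (hu : IsPositiveRadial k f a I u w) {r : ℝ} (hr : r ∈ I) : I ∈ 𝓝 r := by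
  obtain ⟨r', hr', h⟩ := hu.exists_gt r hr
  exact mem_of_superset (Ioo_mem_nhds (hu.lt_of_mem r hr) h)
    fun x hx => hu.left_subset r' hr' ⟨hx.1, hx.2.le⟩

theorem exists_right (hu : IsPositiveRadial k f a I u w) {r ε : ℝ} (hr : r ∈ I) (hε : 0 < ε) :
    ∃ r' ∈ I, r < r' ∧ u r' < ε := by
  obtain ⟨r₀, h₀, h⟩ := hu.right ε hε
  have hm : max r r₀ ∈ I := by rcases max_choice r r₀ with h | h <;> rwa [h]
  obtain ⟨r', hr', hlt⟩ := hu.exists_gt _ hm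
  exact ⟨r', hr', (le_max_left _ _).trans_lt hlt, h r' hr' ((le_max_right _ _).trans_lt hlt)⟩

theorem exists_left (hu : IsPositiveRadial k f a I u w) {r ε : ℝ} (hr : a < r) (hε : 0 < ε) :
    ∃ r', a < r' ∧ r' < r ∧ u r' < ε := by
  obtain ⟨x, hx1, hx2⟩ := ((hu.left.eventually (gt_mem_nhds hε)).and
    (Ioo_mem_nhdsGT hr)).exists
  exact ⟨x, hx2.1, hx2.2, hx1⟩

theorem energy_antitone (hA : IsAdmissible k f F β) (hu : IsPositiveRadial k f a I u w)
    {x y : ℝ} (hx : x ∈ I) (hy : y ∈ I) (hxy : x ≤ y) :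
    w y ^ 2 + 2 * F (u y) ≤ w x ^ 2 + 2 * F (u x) := by
  refine le_of_hasDerivAt_nonpos (φ := fun r => w r ^ 2 + 2 * F (u r))
    (φ' := fun r => -(2 * (k + 1) / r * w r ^ 2)) hxy (fun r hr => ?_) fun r hr => ?_
  · have hr' := hu.Icc_subset hx hy hr
    refine (((hu.hasDerivAt_w r hr').pow 2).add (((hA.hasDerivAt _ (hu.pos r hr')).comp r
      (hu.hasDerivAt_u r hr')).const_mul 2)).congr_deriv ?_
    push_cast
    ring
  · have : 0 < r := hu.a_pos.trans ((hu.lt_of_mem x hx).trans hr.1)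
    rw [neg_nonpos]
    positivity

/-- The energy decreases in r, and F(u) → 0 at the right end, so negative energy is impossible. -/
theorem energy_pos (hA : IsAdmissible k f F β) (hu : IsPositiveRadial k f a I u w) {r : ℝ}
    (hr : r ∈ I) : 0 < w r ^ 2 + 2 * F (u r) := by
  have hnonneg : ∀ r ∈ I, 0 ≤ w r ^ 2 + 2 * F (u r) := by
    intro r hr
    by_contra hneg
    rw [not_le] at hneg
    obtain ⟨δ, hδ, hδF⟩ := (mem_nhdsGT_iff_exists_Ioo_subset).1
      (hA.tendsto_zero.eventually (lt_mem_nhds (show (w r ^ 2 + 2 * F (u r)) / 2 < 0 by linarith)))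
    obtain ⟨r', hr', hlt, hur'⟩ := hu.exists_right hr hδ
    have h1 := hu.energy_antitone hA hr hr' hlt.le
    have h2 : (w r ^ 2 + 2 * F (u r)) / 2 < F (u r') := hδF ⟨hu.pos r' hr', hur'⟩
    nlinarith [sq_nonneg (w r')]
  by_contra hneg
  rw [not_lt] at hneg
  -- Zero energy at r would persist. The dissipation 2(k+1)w²/x would then vanish, making u
  -- constant, although it takes arbitrarily small values.
  have hzero : ∀ x ∈ I, r ≤ x → w x ^ 2 + 2 * F (u x) = 0 := fun x hx hrx =>
    le_antisymm ((hu.energy_antitone hA hr hx hrx).trans hneg) (hnonneg x hx)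
  have hw : ∀ x ∈ I, r < x → w x = 0 := by
    intro x hx hrx
    have hx0 : 0 < x := hu.a_pos.trans (hu.lt_of_mem x hx)
    have hd := ((hu.hasDerivAt_w x hx).pow 2).add (((hA.hasDerivAt _ (hu.pos x hx)).comp x
      (hu.hasDerivAt_u x hx)).const_mul 2)
    have hc : HasDerivAt (w ^ 2 + fun y => 2 * (F ∘ u) y) 0 x := by
      refine (hasDerivAt_const x (0 : ℝ)).congr_of_eventuallyEq ?_
      filter_upwards [hu.mem_nhds hx, Ioi_mem_nhds hrx] with y hy hy'
      exact hzero y hy (le_of_lt hy')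
    have := hd.unique hc
    have h2 : (2 * (k + 1) / x) * w x ^ 2 = 0 := by
      push_cast at this
      linear_combination -this
    have h3 : (2 * ((k : ℝ) + 1) / x) ≠ 0 := by positivity
    exact pow_eq_zero_iff two_ne_zero |>.1 ((mul_eq_zero.1 h2).resolve_left h3)
  obtain ⟨x, hx, hrx⟩ := hu.exists_gt r hr
  obtain ⟨y, hy, hxy, huy⟩ := hu.exists_right hx (hu.pos x hx)
  have := le_of_hasDerivAt_nonneg hxy.le
    (fun z hz => hu.hasDerivAt_u z (hu.Icc_subset hx hy hz))
    (fun z hz => (hw z (hu.Icc_subset hx hy (Ioo_subset_Icc_self hz)) (hrx.trans hz.1)).ge)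
  linarith

/-- The domain is not compact, but near both ends u is below the reference value u r₀. The maximum
over a compact middle interval is therefore global. -/
theorem exists_peak (hu : IsPositiveRadial k f a I u w) : ∃ m ∈ I, ∀ r ∈ I, u r ≤ u m := by
  obtain ⟨r₀, h₀⟩ := hu.nonempty
  obtain ⟨x, hx, hxu⟩ := (mem_nhdsGT_iff_exists_Ioo_subset).1
    (hu.left.eventually (gt_mem_nhds (hu.pos r₀ h₀)))
  obtain ⟨r₁, h₁, hr₁⟩ := hu.right (u r₀) (hu.pos r₀ h₀)
  have hax : a < x := hx
  have har := hu.lt_of_mem r₀ h₀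
  have hx₀ : min r₀ ((a + x) / 2) ∈ I :=
    hu.left_subset r₀ h₀ ⟨lt_min har (by linarith), min_le_left _ _⟩
  have hy₀ : max r₀ r₁ ∈ I := by rcases max_choice r₀ r₁ with h | h <;> rwa [h]
  have hsub := hu.Icc_subset hx₀ hy₀
  obtain ⟨m, hm, hmax⟩ := isCompact_Icc.exists_isMaxOn
    (f := u) (s := Icc (min r₀ ((a + x) / 2)) (max r₀ r₁)) ⟨r₀, min_le_left _ _, le_max_left _ _⟩
    (fun r hr => (hu.hasDerivAt_u r (hsub hr)).continuousAt.continuousWithinAt)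
  have hm₀ : u r₀ ≤ u m := hmax ⟨min_le_left _ _, le_max_left _ _⟩
  refine ⟨m, hsub hm, fun r hr => ?_⟩
  by_cases h1 : r < min r₀ ((a + x) / 2)
  · have : u r < u r₀ :=
      hxu ⟨hu.lt_of_mem r hr, by linarith [h1.trans_le (min_le_right r₀ ((a + x) / 2))]⟩
    linarith
  by_cases h2 : max r₀ r₁ < r
  · have := hr₁ r hr ((le_max_right _ _).trans_lt h2)
    linarith
  exact hmax ⟨not_lt.1 h1, not_lt.1 h2⟩

theorem lt_of_slope_eq_zero (hA : IsAdmissible k f F β) (hu : IsPositiveRadial k f a I u w) {r : ℝ}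
    (hr : r ∈ I) (h : w r = 0) : β < u r := by
  by_contra hn
  have h1 := hu.energy_pos hA hr
  have h2 := hA.F_nonpos (u r) ⟨hu.pos r hr, not_lt.1 hn⟩
  rw [h] at h1
  linarith

theorem eventually_slope_div_neg (hA : IsAdmissible k f F β) (hu : IsPositiveRadial k f a I u w)
    {r : ℝ} (hr : r ∈ I) (h : w r = 0) : ∀ᶠ x in 𝓝[≠] r, w x / (x - r) < 0 := by
  have hβ := hA.one_lt
  have hf := hA.f_pos (u r) (hβ.trans (hu.lt_of_slope_eq_zero hA hr h))
  have hd := hasDerivAt_iff_tendsto_slope.1 (hu.hasDerivAt_w r hr)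
  rw [h, mul_zero, neg_zero, zero_sub] at hd
  filter_upwards [hd.eventually (gt_mem_nhds (neg_neg_of_pos hf))] with x hx
  rwa [slope_def_field, h, sub_zero] at hx

theorem eventually_slope_neg (hA : IsAdmissible k f F β) (hu : IsPositiveRadial k f a I u w)
    {r : ℝ} (hr : r ∈ I) (h : w r = 0) : ∀ᶠ x in 𝓝[>] r, w x < 0 := by
  filter_upwards [(hu.eventually_slope_div_neg hA hr h).filter_mono
    (nhdsWithin_mono r fun x (hx : r < x) => hx.ne'), self_mem_nhdsWithin] with x hx hxr
  have : 0 < x - r := sub_pos.2 hxr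
  exact (div_neg_iff.1 hx).elim (fun h => absurd h.2 (not_lt.2 this.le)) fun h => h.1

theorem eventually_slope_pos (hA : IsAdmissible k f F β) (hu : IsPositiveRadial k f a I u w)
    {r : ℝ} (hr : r ∈ I) (h : w r = 0) : ∀ᶠ x in 𝓝[<] r, 0 < w x := by
  filter_upwards [(hu.eventually_slope_div_neg hA hr h).filter_mono
    (nhdsWithin_mono r fun x (hx : x < r) => hx.ne), self_mem_nhdsWithin] with x hx hxr
  have : x - r < 0 := sub_neg.2 hxr
  exact (div_neg_iff.1 hx).elim (fun h => h.1) fun h => absurd h.2 (not_lt.2 this.le)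

/-- Just to the right of any zero the slope is negative, so no zero can precede an interval of
positive slope. -/
theorem slope_up (hA : IsAdmissible k f F β) (hu : IsPositiveRadial k f a I u w) {m r : ℝ}
    (hm : m ∈ I) (h : w m = 0) (hr : r ∈ I) (hrm : r < m) : 0 < w r := by
  refine pos_of_no_last_zero
    (fun t ht => (hu.hasDerivAt_w t (hu.Icc_subset hr hm ⟨ht.1, ht.2.le⟩)).continuousAt.continuousWithinAt)
    (hu.eventually_slope_pos hA hm h) (fun t ht hpos h0 => ?_) r ⟨le_rfl, hrm⟩
  obtain ⟨x, hx1, hx2⟩ := ((hu.eventually_slope_neg hA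
    (hu.Icc_subset hr hm ⟨ht.1, ht.2.le⟩) h0).and (Ioo_mem_nhdsGT ht.2)).exists
  exact lt_asymm hx1 (hpos x hx2)

theorem slope_down (hA : IsAdmissible k f F β) (hu : IsPositiveRadial k f a I u w) {m r : ℝ}
    (hm : m ∈ I) (h : w m = 0) (hr : r ∈ I) (hrm : m < r) : w r < 0 := by
  refine neg_pos.1 (pos_of_no_first_zero (φ := fun t => -w t) (a := m) (b := r)
    (fun t ht => (hu.hasDerivAt_w t
      (hu.Icc_subset hm hr ⟨ht.1.le, ht.2⟩)).neg.continuousAt.continuousWithinAt)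
    ((hu.eventually_slope_neg hA hm h).mono fun x hx => neg_pos.2 hx)
    (fun t ht hpos h0 => ?_) r ⟨hrm, le_rfl⟩)
  obtain ⟨x, hx1, hx2⟩ := ((hu.eventually_slope_pos hA
    (hu.Icc_subset hm hr ⟨ht.1.le, ht.2⟩) (neg_eq_zero.1 h0)).and (Ioo_mem_nhdsLT ht.1)).exists
  exact lt_asymm hx1 (neg_pos.1 (hpos x hx2))

end IsPositiveRadial

namespace IsBumpOf

variable {k : ℕ} {f F : ℝ → ℝ} {β a M m : ℝ} {I : Set ℝ} {u w R Y R' Y' : ℝ → ℝ}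

theorem lt_of_lt_peak (hu : IsPositiveRadial k f a I u w) (hb : IsBumpOf a I u w M m R Y R' Y')
    {x y : ℝ} (hx : x ∈ I) (hxy : x < y) (hy : y ≤ m) : u x < u y := by
  have hsub : Icc x y ⊆ I := fun z hz => hu.Icc_subset hx hb.peak_mem ⟨hz.1, hz.2.trans hy⟩
  exact lt_of_hasDerivAt_pos hxy (fun z hz => hu.hasDerivAt_u z (hsub hz))
    (fun z hz => hb.slope_up z (hsub (Ioo_subset_Icc_self hz)) (hz.2.trans_le hy))

theorem lt_of_peak_lt (hu : IsPositiveRadial k f a I u w) (hb : IsBumpOf a I u w M m R Y R' Y')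
    {x y : ℝ} (hx : m ≤ x) (hxy : x < y) (hy : y ∈ I) : u y < u x := by
  have hsub : Icc x y ⊆ I := fun z hz => hu.Icc_subset hb.peak_mem hy ⟨hx.trans hz.1, hz.2⟩
  exact lt_of_hasDerivAt_neg hxy (fun z hz => hu.hasDerivAt_u z (hsub hz))
    (fun z hz => hb.slope_down z (hsub (Ioo_subset_Icc_self hz)) (hx.trans_lt hz.1))

theorem R_mem_I (hu : IsPositiveRadial k f a I u w) (hb : IsBumpOf a I u w M m R Y R' Y')
    {s : ℝ} (hs : s ∈ Ioo 0 M) : R s ∈ I :=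
  hu.left_subset m hb.peak_mem (Ioo_subset_Ioc_self (hb.R_mem s hs))

theorem R'_u (hu : IsPositiveRadial k f a I u w) (hb : IsBumpOf a I u w M m R Y R' Y')
    {r : ℝ} (hr : r ∈ I) (hmr : m < r) : R' (u r) = r := by
  have h := hb.lt_of_peak_lt hu le_rfl hmr hr
  rw [hb.u_peak] at h
  have hs : u r ∈ Ioo 0 M := ⟨hu.pos r hr, h⟩
  have h1 := hb.u_R' _ hs
  rcases lt_trichotomy (R' (u r)) r with hlt | heq | hlt
  · exact absurd h1 (hb.lt_of_peak_lt hu (hb.lt_R' _ hs).le hlt hr).ne'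
  · exact heq
  · exact absurd h1 (hb.lt_of_peak_lt hu hmr.le hlt (hb.R'_mem _ hs)).ne

/-- Superlevel sets of a one-bump function are intervals, so comparing radii amounts to comparing
the functions. -/
theorem lt_iff (hu : IsPositiveRadial k f a I u w) (hb : IsBumpOf a I u w M m R Y R' Y')
    {s r : ℝ} (hs : s ∈ Ioo 0 M) (hr : r ∈ I) : s < u r ↔ R s < r ∧ r < R' s := by
  have hm := (hb.R_mem s hs).2
  have hm' := hb.lt_R' s hs
  constructor
  · intro h
    constructor
    · by_contra hn
      rw [not_lt] at hn
      rcases hn.eq_or_lt with rfl | hn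
      · rw [hb.u_R s hs] at h
        exact lt_irrefl _ h
      · have := hb.lt_of_lt_peak hu hr hn hm.le
        rw [hb.u_R s hs] at this
        exact lt_asymm h this
    · by_contra hn
      rw [not_lt] at hn
      rcases hn.eq_or_lt with rfl | hn
      · rw [hb.u_R' s hs] at h
        exact lt_irrefl _ h
      · have := hb.lt_of_peak_lt hu hm'.le hn hr
        rw [hb.u_R' s hs] at this
        exact lt_asymm h this
  · rintro ⟨h1, h2⟩
    rcases le_total r m with h | h
    · have := hb.lt_of_lt_peak hu (hb.R_mem_I hu hs) h1 h
      rwa [hb.u_R s hs] at this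
    · have := hb.lt_of_peak_lt hu h h2 (hb.R'_mem s hs)
      rwa [hb.u_R' s hs] at this

end IsBumpOf

/-! ### Construction of the two branches -/

theorem IsPositiveRadial.exists_bump {k : ℕ} {f F : ℝ → ℝ} {β a : ℝ} {I : Set ℝ} {u w : ℝ → ℝ}
    (hA : IsAdmissible k f F β) (hu : IsPositiveRadial k f a I u w) :
    ∃ (M m α : ℝ) (R Y R' Y' : ℝ → ℝ), β < M ∧ IsBumpOf a I u w M m R Y R' Y' ∧
      IsBump k f F a M m α R Y R' Y' := by
  obtain ⟨m, hm, hmax⟩ := hu.exists_peak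
  have hwm : w m = 0 := IsLocalMax.hasDerivAt_eq_zero
    (by filter_upwards [hu.mem_nhds hm] with r hr using hmax r hr) (hu.hasDerivAt_u m hm)
  have ham := hu.lt_of_mem m hm
  have hβM := hu.lt_of_slope_eq_zero hA hm hwm
  have hβ := hA.one_lt
  have hup : ∀ r ∈ I, r < m → 0 < w r := fun r hr h => hu.slope_up hA hm hwm hr h
  have hdown : ∀ r ∈ I, m < r → w r < 0 := fun r hr h => hu.slope_down hA hm hwm hr h
  have hupsub : Ioo a m ⊆ I := Ioo_subset_Ioc_self.trans (hu.left_subset m hm)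
  have hcont : ∀ r ∈ I, ContinuousAt u r := fun r hr => (hu.hasDerivAt_u r hr).continuousAt
  have hmono : StrictMonoOn u (Ioo a m) := fun x hx y hy hxy =>
    lt_of_hasDerivAt_pos hxy
      (fun z hz => hu.hasDerivAt_u z (hupsub ⟨hx.1.trans_le hz.1, hz.2.trans_lt hy.2⟩))
      (fun z hz => hup z (hupsub ⟨hx.1.trans hz.1, hz.2.trans hy.2⟩) (hz.2.trans hy.2))
  have hanti : StrictAntiOn u (I ∩ Ioi m) := fun x hx y hy hxy =>
    lt_of_hasDerivAt_neg hxy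
      (fun z hz => hu.hasDerivAt_u z (hu.Icc_subset hx.1 hy.1 hz))
      (fun z hz => hdown z (hu.Icc_subset hx.1 hy.1 (Ioo_subset_Icc_self hz))
        (lt_trans hx.2 hz.1))
  obtain ⟨R, hR, hbR⟩ := exists_isBranch (k := k) (f := f) (σ := 1) (M := u m) (J := Ioo a m)
    (u := u) (w := w) (by norm_num) (fun r hr => Ioo_mem_nhds hr.1 hr.2)
    (fun r hr => hu.a_pos.trans hr.1) (fun r hr => hu.hasDerivAt_u r (hupsub hr))
    (fun r hr => hu.hasDerivAt_w r (hupsub hr))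
    (fun r hr => by simpa using hup r (hupsub hr) hr.2) hmono.injOn (fun s hs => by
      obtain ⟨x, hx1, hx2, hx3⟩ := hu.exists_left ham hs.1
      have hxI := hupsub ⟨hx1, hx2⟩
      obtain ⟨r, hr, hrs⟩ := intermediate_value_Icc hx2.le
        (fun z hz => (hcont z (hu.Icc_subset hxI hm hz)).continuousWithinAt) ⟨hx3.le, hs.2.le⟩
      refine ⟨r, ⟨hx1.trans_le hr.1, hr.2.lt_of_ne ?_⟩, hrs⟩
      rintro rfl
      exact hs.2.ne hrs.symm)
  obtain ⟨R', hR', hbR'⟩ := exists_isBranch (k := k) (f := f) (σ := -1) (M := u m)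
    (J := I ∩ Ioi m) (u := u) (w := w) (by norm_num)
    (fun r hr => inter_mem (hu.mem_nhds hr.1) (Ioi_mem_nhds hr.2))
    (fun r hr => hu.a_pos.trans (hu.lt_of_mem r hr.1)) (fun r hr => hu.hasDerivAt_u r hr.1)
    (fun r hr => hu.hasDerivAt_w r hr.1)
    (fun r hr => by simpa using hdown r hr.1 hr.2) hanti.injOn (fun s hs => by
      obtain ⟨y, hy1, hy2, hy3⟩ := hu.exists_right hm hs.1
      obtain ⟨r, hr, hrs⟩ := intermediate_value_Icc' hy2.le
        (fun z hz => (hcont z (hu.Icc_subset hm hy1 hz)).continuousWithinAt) ⟨hy3.le, hs.2.le⟩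
      refine ⟨r, ⟨hu.Icc_subset hm hy1 hr, lt_of_le_of_ne hr.1 ?_⟩, hrs⟩
      rintro rfl
      exact hs.2.ne hrs.symm)
  have hM0 : 0 < u m := hu.pos m hm
  have hwc : ContinuousAt w m := (hu.hasDerivAt_w m hm).continuousAt
  have hE : ∀ s ∈ Ioo 0 (u m), 0 < branchEnergy F (fun s => 1 * w (R s)) s := fun s hs => by
    have := hu.energy_pos hA (hupsub (hR s hs).1)
    rw [(hR s hs).2] at this
    simpa [branchEnergy] using this
  have hE' : ∀ s ∈ Ioo 0 (u m), 0 < branchEnergy F (fun s => -1 * w (R' s)) s := fun s hs => by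
    have := hu.energy_pos hA (hR' s hs).1.1
    rw [(hR' s hs).2] at this
    simpa [branchEnergy] using this
  have hR0 : Tendsto R (𝓝[>] 0) (𝓝 a) := by
    refine tendsto_order.2 ⟨fun x hx => ?_, fun x hx => ?_⟩
    · filter_upwards [Ioo_mem_nhdsGT hM0] with s hs
      exact hx.trans (hR s hs).1.1
    · obtain ⟨r, har, hr⟩ := exists_between (lt_min hx ham)
      have hrI : r ∈ Ioo a m := ⟨har, hr.trans_le (min_le_right _ _)⟩
      filter_upwards [Ioo_mem_nhdsGT (lt_min hM0 (hu.pos r (hupsub hrI)))] with s hs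
      have hsM : s ∈ Ioo 0 (u m) := ⟨hs.1, hs.2.trans_le (min_le_left _ _)⟩
      refine lt_trans ?_ (hr.trans_le (min_le_left _ _))
      refine (hmono.lt_iff_lt (hR s hsM).1 hrI).1 ?_
      rw [(hR s hsM).2]
      exact hs.2.trans_le (min_le_right _ _)
  have hRM : Tendsto R (𝓝[<] (u m)) (𝓝 m) := by
    refine tendsto_order.2 ⟨fun x hx => ?_, fun x hx => ?_⟩
    · obtain ⟨r, har, hr⟩ := exists_between (max_lt hx ham)
      have hrI : r ∈ Ioo a m := ⟨(le_max_right _ _).trans_lt har, hr⟩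
      have hrM : u r < u m := lt_of_hasDerivAt_pos hr
        (fun z hz => hu.hasDerivAt_u z (hu.Icc_subset (hupsub hrI) hm hz))
        (fun z hz => hup z (hu.Icc_subset (hupsub hrI) hm (Ioo_subset_Icc_self hz)) hz.2)
      filter_upwards [Ioo_mem_nhdsLT hrM] with s hs
      have hsM : s ∈ Ioo 0 (u m) := ⟨(hu.pos r (hupsub hrI)).trans hs.1, hs.2⟩
      refine ((le_max_left _ _).trans_lt har).trans ?_
      refine (hmono.lt_iff_lt hrI (hR s hsM).1).1 ?_
      rw [(hR s hsM).2]
      exact hs.1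
    · filter_upwards [Ioo_mem_nhdsLT hM0] with s hs
      exact (hR s hs).1.2.trans hx
  have hRM' : Tendsto R' (𝓝[<] (u m)) (𝓝 m) := by
    refine tendsto_order.2 ⟨fun x hx => ?_, fun x hx => ?_⟩
    · filter_upwards [Ioo_mem_nhdsLT hM0] with s hs
      exact hx.trans (hR' s hs).1.2
    · obtain ⟨b, hb, hmb⟩ := hu.exists_gt m hm
      obtain ⟨r, har, hr⟩ := exists_between (lt_min hx hmb)
      have hrI : r ∈ I ∩ Ioi m :=
        ⟨hu.Icc_subset hm hb ⟨har.le, (hr.trans_le (min_le_right _ _)).le⟩, har⟩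
      have hrM : u r < u m := lt_of_hasDerivAt_neg har
        (fun z hz => hu.hasDerivAt_u z (hu.Icc_subset hm hrI.1 hz))
        (fun z hz => hdown z (hu.Icc_subset hm hrI.1 (Ioo_subset_Icc_self hz)) hz.1)
      filter_upwards [Ioo_mem_nhdsLT hrM] with s hs
      have hsM : s ∈ Ioo 0 (u m) := ⟨(hu.pos r hrI.1).trans hs.1, hs.2⟩
      refine lt_trans ?_ (hr.trans_le (min_le_left _ _))
      refine (hanti.lt_iff_gt hrI (hR' s hsM).1).1 ?_
      rw [(hR' s hsM).2]
      exact hs.1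
  have hYM : Tendsto (fun s => 1 * w (R s)) (𝓝[<] (u m)) (𝓝 0) := by
    have := (hwc.tendsto.comp hRM).const_mul 1
    rwa [hwm, mul_zero] at this
  have hYM' : Tendsto (fun s => -1 * w (R' s)) (𝓝[<] (u m)) (𝓝 0) := by
    have := (hwc.tendsto.comp hRM').const_mul (-1)
    rwa [hwm, mul_zero] at this
  -- The solution is only known to be continuous at a. Its slope there is obtained as a limit of the
  -- flux, which is monotone for values below 1 because f ≤ 0.
  have hQmono : MonotoneOn (branchFlux k R (fun s => 1 * w (R s))) (Ioo 0 1) := by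
    intro x hx y hy hxy
    refine le_of_hasDerivAt_nonneg hxy
      (fun z hz => hbR.hasDerivAt_flux ⟨hx.1.trans_le hz.1, by linarith [hz.2, hy.2]⟩) fun z hz => ?_
    have hz' : z ∈ Ioo 0 (u m) := ⟨hx.1.trans hz.1, by linarith [hz.2, hy.2]⟩
    have h1 := hbR.R_pos z hz'
    have h2 := hbR.Y_pos z hz'
    have h3 := hA.f_nonpos z ⟨hz'.1, by linarith [hz.2, hy.2]⟩
    rw [← neg_div, ← mul_neg]
    have h4 : 0 ≤ -f z := by linarith
    positivity
  have hQ0 := hQmono.tendsto_nhdsWithin_Ioo_right ⟨1 / 2, by norm_num, by norm_num⟩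
    ⟨0, by
      rintro _ ⟨s, hs, rfl⟩
      exact (hbR.flux_pos ⟨hs.1, by linarith [hs.2]⟩).le⟩
  set Q₀ := sInf (branchFlux k R (fun s => 1 * w (R s)) '' Ioo 0 1)
  have hak : a ^ (k + 1) ≠ 0 := (pow_pos hu.a_pos _).ne'
  have hY0 : Tendsto (fun s => 1 * w (R s)) (𝓝[>] 0) (𝓝 (Q₀ / a ^ (k + 1))) := by
    refine (hQ0.div (hR0.pow (k + 1)) hak).congr' ?_
    filter_upwards [Ioo_mem_nhdsGT hM0] with s hs
    have := (pow_pos (hbR.R_pos s hs) (k + 1)).ne'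
    simp only [branchFlux, Pi.div_apply]
    field_simp
  have hα : 0 < Q₀ / a ^ (k + 1) := by
    have h1 : (1 : ℝ) ∈ Ioo 0 (u m) := ⟨one_pos, by linarith⟩
    -- The limiting slope is nonzero because its square bounds the positive energy at the value 1.
    have hsq : branchEnergy F (fun s => 1 * w (R s)) 1 ≤ (Q₀ / a ^ (k + 1)) ^ 2 := by
      refine ge_of_tendsto (hY0.pow 2) ?_
      filter_upwards [Ioo_mem_nhdsGT one_pos] with s hs
      have hs' : s ∈ Ioo 0 (u m) := ⟨hs.1, hs.2.trans h1.2⟩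
      have := hu.energy_antitone hA (hupsub (hR s hs').1) (hupsub (hR 1 h1).1)
        ((hmono.le_iff_le (hR s hs').1 (hR 1 h1).1).1 (by
          rw [(hR s hs').2, (hR 1 h1).2]
          exact hs.2.le))
      rw [(hR s hs').2, (hR 1 h1).2] at this
      have hF := hA.F_nonpos s ⟨hs.1, by linarith [hs.2]⟩
      simp only [branchEnergy]
      linarith
    have h0 : 0 ≤ Q₀ / a ^ (k + 1) := by
      refine ge_of_tendsto hY0 ?_
      filter_upwards [Ioo_mem_nhdsGT hM0] with s hs
      exact (hbR.Y_pos s hs).le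
    have h2 := (hE 1 h1).trans_le hsq
    exact h0.lt_of_ne fun h => by rw [← h] at h2; norm_num at h2
  exact ⟨u m, m, Q₀ / a ^ (k + 1), R, fun s => 1 * w (R s), R', fun s => -1 * w (R' s), hβM,
    ⟨hm, rfl, hup, hdown, fun s hs => (hR s hs).1, fun s hs => (hR s hs).2,
      fun s _ => one_mul _, fun s hs => (hR' s hs).1.1, fun s hs => (hR' s hs).1.2,
      fun s hs => (hR' s hs).2, fun s _ => neg_one_mul _⟩,
    ⟨hbR, hbR', hE, hE', hα, hR0, hY0, hRM, hRM', hYM, hYM', hu.a_pos.trans ham⟩⟩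

/-! ### Sturm comparison at level 1 -/

section Sturm

variable {k : ℕ} {f F : ℝ → ℝ} {β a M₁ M₂ m₁ m₂ : ℝ} {I : Set ℝ}
  {u w v z R₁ Y₁ R₁' Y₁' R₂ Y₂ R₂' Y₂' : ℝ → ℝ}

/-- Sturm comparison with respect to the level `1`: the decreasing branches cross above it. -/
theorem IsBumpOf.not_forall_radius_lt (hu : IsPositiveRadial k f a I u w)
    (hv : IsPositiveRadial k f a I v z) (hbu : IsBumpOf a I u w M₁ m₁ R₁ Y₁ R₁' Y₁')
    (hbv : IsBumpOf a I v z M₂ m₂ R₂ Y₂ R₂' Y₂')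
    (hf : ∀ x y, 1 ≤ x → x ≤ y → f x * (y - 1) ≤ f y * (x - 1)) (hM₁ : 1 < M₁) (hM : M₁ < M₂)
    (hR : ∀ s ∈ Ico 1 M₁, R₂ s < R₁ s) : ¬ ∀ s ∈ Ico 1 M₁, R₁' s < R₂' s := by
  intro hR'
  have h1 : (1 : ℝ) ∈ Ioo 0 M₁ := ⟨one_pos, hM₁⟩
  have h1' : (1 : ℝ) ∈ Ioo 0 M₂ := ⟨one_pos, hM₁.trans hM⟩
  have hcI := hbu.R_mem_I hu h1
  have hdI := hbu.R'_mem 1 h1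
  have hcd : R₁ 1 < R₁' 1 := (hbu.R_mem 1 h1).2.trans (hbu.lt_R' 1 h1)
  have hv1 : ∀ r ∈ Icc (R₁ 1) (R₁' 1), 1 < v r := fun r hr =>
    (hbv.lt_iff hv h1' (hu.Icc_subset hcI hdI hr)).2
      ⟨(hR 1 ⟨le_rfl, hM₁⟩).trans_le hr.1, hr.2.trans_lt (hR' 1 ⟨le_rfl, hM₁⟩)⟩
  have hu1 : ∀ r ∈ Ioo (R₁ 1) (R₁' 1), 1 < u r := fun r hr =>
    (hbu.lt_iff hu h1 (hu.Icc_subset hcI hdI (Ioo_subset_Icc_self hr))).2 hr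
  -- The superlevel sets of u at levels in [1, M₁) lie inside those of v.
  have huv : ∀ r ∈ Ioo (R₁ 1) (R₁' 1), u r ≤ v r := by
    intro r hr
    have hrI := hu.Icc_subset hcI hdI (Ioo_subset_Icc_self hr)
    refine le_of_forall_lt fun s hs => ?_
    rcases lt_or_ge s 1 with hs1 | hs1
    · exact hs1.trans (hv1 r (Ioo_subset_Icc_self hr))
    have huM : u r ≤ M₁ := by
      rcases lt_trichotomy r m₁ with h | h | h
      · have := hbu.lt_of_lt_peak hu hrI h le_rfl
        rw [hbu.u_peak] at this
        exact this.le
      · rw [h, hbu.u_peak]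
      · have := hbu.lt_of_peak_lt hu le_rfl h hrI
        rw [hbu.u_peak] at this
        exact this.le
    have hsM : s ∈ Ico 1 M₁ := ⟨hs1, hs.trans_le huM⟩
    have hs₁ : s ∈ Ioo 0 M₁ := ⟨by linarith, hsM.2⟩
    have := (hbu.lt_iff hu hs₁ hrI).1 hs
    exact (hbv.lt_iff hv ⟨hs₁.1, hs₁.2.trans hM⟩ hrI).2
      ⟨(hR s hsM).trans this.1, this.2.trans (hR' s hsM)⟩
  -- The weighted Wronskian of u - 1 and v - 1 is nonincreasing, as f(s)/(s - 1) is nondecreasing.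
  -- At the two points where u = 1 < v the slopes of u make it negative on the left and positive on
  -- the right, a contradiction.
  have hder := le_of_hasDerivAt_nonpos
    (φ := fun r => r ^ (k + 1) * (z r * (u r - 1) - w r * (v r - 1)))
    (φ' := fun r => r ^ (k + 1) * (f (u r) * (v r - 1) - f (v r) * (u r - 1))) hcd.le
    (fun r hr => by
      have hrI := hu.Icc_subset hcI hdI hr
      have hr0 : r ≠ 0 := (hu.a_pos.trans (hu.lt_of_mem r hrI)).ne'
      refine ((hasDerivAt_pow (k + 1) r).mul
        (((hv.hasDerivAt_w r hrI).mul ((hu.hasDerivAt_u r hrI).sub_const 1)).sub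
        ((hu.hasDerivAt_w r hrI).mul ((hv.hasDerivAt_u r hrI).sub_const 1)))).congr_deriv ?_
      simp only [Pi.mul_apply, Pi.sub_apply, Nat.add_sub_cancel]
      push_cast
      field_simp
      ring)
    (fun r hr => by
      have hrI := hu.Icc_subset hcI hdI (Ioo_subset_Icc_self hr)
      have hr0 : 0 < r := hu.a_pos.trans (hu.lt_of_mem r hrI)
      have := hf (u r) (v r) (hu1 r hr).le (huv r hr)
      have h2 : 0 < r ^ (k + 1) := by positivity
      nlinarith)
  simp only [hbu.u_R 1 h1, hbu.u_R' 1 h1, sub_self, mul_zero, zero_sub] at hder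
  have hc := hbu.slope_up _ hcI (hbu.R_mem 1 h1).2
  have hd := hbu.slope_down _ hdI (hbu.lt_R' 1 h1)
  have hvc := hv1 (R₁ 1) ⟨le_rfl, hcd.le⟩
  have hvd := hv1 (R₁' 1) ⟨hcd.le, le_rfl⟩
  have hpc : 0 < R₁ 1 ^ (k + 1) := pow_pos (hu.a_pos.trans (hu.lt_of_mem _ hcI)) _
  have hpd : 0 < R₁' 1 ^ (k + 1) := pow_pos (hu.a_pos.trans (hu.lt_of_mem _ hdI)) _
  have e1 : 0 < R₁ 1 ^ (k + 1) * (w (R₁ 1) * (v (R₁ 1) - 1)) :=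
    mul_pos hpc (mul_pos hc (by linarith))
  have e2 : 0 < R₁' 1 ^ (k + 1) * (-w (R₁' 1) * (v (R₁' 1) - 1)) :=
    mul_pos hpd (mul_pos (by linarith) (by linarith))
  linarith

end Sturm

/-! ### Equal initial slopes, and the resulting dichotomy -/

section Uniqueness

variable {k : ℕ} {f F : ℝ → ℝ} {β a : ℝ} {I : Set ℝ} {u w v z : ℝ → ℝ}

/-- Gronwall for (u - v)² + (w - z)², in both directions from r₀. Both solutions stay away from 0 on
compact subintervals, so a Lipschitz bound on [ε, A] suffices. -/
theorem IsPositiveRadial.eq_of_eq_at (hu : IsPositiveRadial k f a I u w)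
    (hv : IsPositiveRadial k f a I v z)
    (hf : ∀ ε A, 0 < ε → ∃ L, 0 ≤ L ∧ ∀ x ∈ Icc ε A, ∀ y ∈ Icc ε A, |f x - f y| ≤ L * |x - y|)
    {r₀ : ℝ} (h₀ : r₀ ∈ I) (heq : u r₀ = v r₀) (heq' : w r₀ = z r₀) : EqOn u v I := by
  intro r hr
  set x := min r₀ r
  set y := max r₀ r
  have hx : x ∈ I := by rcases min_choice r₀ r with h | h <;> simpa only [x, h]
  have hy : y ∈ I := by rcases max_choice r₀ r with h | h <;> simpa only [y, h]
  have hsub := hu.Icc_subset hx hy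
  have hcu : ContinuousOn u (Icc x y) := fun t ht =>
    (hu.hasDerivAt_u t (hsub ht)).continuousAt.continuousWithinAt
  have hcv : ContinuousOn v (Icc x y) := fun t ht =>
    (hv.hasDerivAt_u t (hsub ht)).continuousAt.continuousWithinAt
  have hne : (Icc x y).Nonempty := ⟨r₀, min_le_left _ _, le_max_left _ _⟩
  obtain ⟨tu, htu, hminu⟩ := isCompact_Icc.exists_isMinOn hne hcu
  obtain ⟨tv, htv, hminv⟩ := isCompact_Icc.exists_isMinOn hne hcv
  obtain ⟨Tu, hTu, hmaxu⟩ := isCompact_Icc.exists_isMaxOn hne hcu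
  obtain ⟨Tv, hTv, hmaxv⟩ := isCompact_Icc.exists_isMaxOn hne hcv
  obtain ⟨L, hL0, hL⟩ := hf (min (u tu) (v tv)) (max (u Tu) (v Tv))
    (lt_min (hu.pos _ (hsub htu)) (hv.pos _ (hsub htv)))
  have hLuv : ∀ t ∈ Icc x y, |f (u t) - f (v t)| ≤ L * |u t - v t| := fun t ht =>
    hL _ ⟨(min_le_left _ _).trans (hminu ht), (hmaxu ht).trans (le_max_left _ _)⟩
      _ ⟨(min_le_right _ _).trans (hminv ht), (hmaxv ht).trans (le_max_right _ _)⟩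
  set D : ℝ → ℝ := fun t => (u t - v t) ^ 2 + (w t - z t) ^ 2 with hD
  set D' : ℝ → ℝ := fun t => 2 * (u t - v t) * (w t - z t) +
    2 * (w t - z t) * (-((k + 1) / t) * (w t - z t) - (f (u t) - f (v t))) with hD'
  have hderiv : ∀ t ∈ Icc x y, HasDerivAt D (D' t) t := fun t ht => by
    refine ((((hu.hasDerivAt_u t (hsub ht)).sub (hv.hasDerivAt_u t (hsub ht))).pow 2).add
      (((hu.hasDerivAt_w t (hsub ht)).sub (hv.hasDerivAt_w t (hsub ht))).pow 2)).congr_deriv ?_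
    simp only [hD', Pi.sub_apply]
    push_cast
    ring
  have hbound : ∀ t ∈ Icc x y, |D' t| ≤ (1 + L + 2 * ((k + 1) / a)) * D t := by
    intro t ht
    have hat := hu.lt_of_mem t (hsub ht)
    have ha := hu.a_pos
    have hka : (k + 1) / t ≤ (k + 1) / a := by gcongr
    have hkt : 0 ≤ (k + 1) / t := by
      have : 0 < t := ha.trans hat
      positivity
    have h1 := abs_le.1 (hLuv t ht)
    have key : |2 * (w t - z t) * (f (u t) - f (v t))| ≤ L * D t := by
      rw [abs_mul, abs_mul, abs_two]
      have h2 := hLuv t ht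
      have h3 := abs_nonneg (w t - z t)
      have h4 : 2 * |w t - z t| * |f (u t) - f (v t)| ≤ 2 * |w t - z t| * (L * |u t - v t|) := by
        gcongr
      have h5 : 2 * |w t - z t| * |u t - v t| ≤ D t := by
        simp only [hD]
        rw [← sq_abs (u t - v t), ← sq_abs (w t - z t)]
        nlinarith [sq_nonneg (|u t - v t| - |w t - z t|)]
      nlinarith
    have key2 : |2 * (u t - v t) * (w t - z t)| ≤ D t := by
      simp only [hD]
      rw [abs_le]
      constructor <;> nlinarith [sq_nonneg (u t - v t - (w t - z t)),
        sq_nonneg (u t - v t + (w t - z t))]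
    have key3 : |2 * ((k + 1) / t) * (w t - z t) ^ 2| ≤ 2 * ((k + 1) / a) * D t := by
      rw [abs_of_nonneg (by positivity)]
      have : (w t - z t) ^ 2 ≤ D t := by
        simp only [hD]
        nlinarith [sq_nonneg (u t - v t)]
      gcongr
    have e : D' t = 2 * (u t - v t) * (w t - z t) - 2 * ((k + 1) / t) * (w t - z t) ^ 2 -
        2 * (w t - z t) * (f (u t) - f (v t)) := by
      simp only [hD']
      ring
    rw [e]
    have a1 := abs_sub (2 * (u t - v t) * (w t - z t) - 2 * ((k + 1) / t) * (w t - z t) ^ 2)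
      (2 * (w t - z t) * (f (u t) - f (v t)))
    have a2 := abs_sub (2 * (u t - v t) * (w t - z t)) (2 * ((k + 1) / t) * (w t - z t) ^ 2)
    linarith
  have hD0 : D r₀ = 0 := by simp [hD, heq, heq']
  have hr₀ : r₀ ∈ Icc x y := ⟨min_le_left _ _, le_max_left _ _⟩
  have hlim : Tendsto D (𝓝 r₀) (𝓝 0) := by
    have := (hderiv r₀ hr₀).continuousAt.tendsto
    rwa [hD0] at this
  have hDnonneg : ∀ t, 0 ≤ D t := fun t => by simp only [hD]; positivity
  have hDr : D r = 0 := by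
    rcases lt_trichotomy r₀ r with h | h | h
    · have hxy : Icc r₀ r ⊆ Icc x y := Icc_subset_Icc (min_le_left _ _) (le_max_right _ _)
      exact eq_zero_of_hasDerivAt_le_mul (hlim.mono_left nhdsWithin_le_nhds)
        (fun t ht => hderiv t (hxy (Ioc_subset_Icc_self ht)))
        (fun t ht => (le_abs_self _).trans (hbound t (hxy (Ioo_subset_Icc_self ht))))
        (fun t _ => hDnonneg t) h
    · rwa [← h]
    · have hxy : Icc r r₀ ⊆ Icc x y := Icc_subset_Icc (min_le_right _ _) (le_max_left _ _)
      have hneg : ∀ t, t ∈ Icc (-r₀) (-r) → -t ∈ Icc r r₀ :=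
        fun t ht => ⟨le_neg.1 ht.2, neg_le.1 ht.1⟩
      have hlim' : Tendsto (fun t => D (-t)) (𝓝[>] (-r₀)) (𝓝 0) := by
        have h1 : Tendsto (fun t : ℝ => -t) (𝓝 (-r₀)) (𝓝 r₀) := by
          simpa using (continuous_neg.tendsto (-r₀))
        exact (hlim.comp h1).mono_left nhdsWithin_le_nhds
      have := eq_zero_of_hasDerivAt_le_mul (b := -r) (L := 1 + L + 2 * ((k + 1) / a)) hlim'
        (fun t ht => ((hderiv (-t) (hxy (hneg t (Ioc_subset_Icc_self ht)))).scomp t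
          (hasDerivAt_neg t)))
        (fun t ht => by
          have := hbound (-t) (hxy (hneg t (Ioo_subset_Icc_self ht)))
          have h2 := neg_abs_le (D' (-t))
          rw [smul_eq_mul]
          linarith)
        (fun t _ => hDnonneg (-t)) (neg_lt_neg h)
      simpa using this
  have : (u r - v r) ^ 2 = 0 := by
    have h1 : (u r - v r) ^ 2 + (w r - z r) ^ 2 = 0 := hDr
    nlinarith [sq_nonneg (u r - v r), sq_nonneg (w r - z r)]
  exact sub_eq_zero.1 (pow_eq_zero_iff two_ne_zero |>.1 this)

theorem quadratic_form_le {x y c d A B : ℝ} (hc : |c| ≤ A) (hd : d ≤ B) (hB : 0 ≤ B) :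
    2 * (x * y) * c + 2 * d * y ^ 2 ≤ (A + 2 * B) * (x ^ 2 + y ^ 2) := by
  have h1 : |2 * (x * y)| ≤ x ^ 2 + y ^ 2 := by
    rw [abs_le]
    constructor <;> nlinarith [sq_nonneg (x - y), sq_nonneg (x + y)]
  have h2 : 2 * (x * y) * c ≤ A * (x ^ 2 + y ^ 2) := by
    calc _ ≤ |2 * (x * y) * c| := le_abs_self _
      _ = |c| * |2 * (x * y)| := by rw [abs_mul, mul_comm]
      _ ≤ _ := by gcongr; exact (abs_nonneg c).trans hc
  have h3 : d * y ^ 2 ≤ B * y ^ 2 := by gcongr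
  nlinarith [mul_nonneg hB (sq_nonneg x)]

/-- Two increasing branches issuing from the same point with the same slope coincide near `0`. -/
theorem IsBranch.exists_eq_of_slope_eq {M₁ M₂ α : ℝ} {R₁ Y₁ R₂ Y₂ : ℝ → ℝ}
    (hu : IsBranch k f 1 M₁ R₁ Y₁) (hv : IsBranch k f 1 M₂ R₂ Y₂) (ha : 0 < a) (hα : 0 < α)
    (hM₁ : 1 < M₁) (hM₂ : 1 < M₂) {C : ℝ} (hC : ∀ s ∈ Ioc 0 1, |f s| ≤ C)
    (haR₁ : ∀ s ∈ Ioo 0 M₁, a < R₁ s) (haR₂ : ∀ s ∈ Ioo 0 M₂, a < R₂ s)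
    (hR₁ : Tendsto R₁ (𝓝[>] 0) (𝓝 a)) (hR₂ : Tendsto R₂ (𝓝[>] 0) (𝓝 a))
    (hY₁ : Tendsto Y₁ (𝓝[>] 0) (𝓝 α)) (hY₂ : Tendsto Y₂ (𝓝[>] 0) (𝓝 α)) :
    ∃ s ∈ Ioo 0 1, R₁ s = R₂ s ∧ Y₁ s = Y₂ s := by
  obtain ⟨δ, hδ, hδY⟩ := (mem_nhdsGT_iff_exists_Ioo_subset).1
    ((hY₁.eventually (lt_mem_nhds (half_lt_self hα))).and
      (hY₂.eventually (lt_mem_nhds (half_lt_self hα))))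
  have hδ0 : 0 < δ := hδ
  set s₀ := min δ 1 / 2
  have hm : 0 < min δ 1 := lt_min hδ0 one_pos
  have hs₀ : 0 < s₀ := half_pos hm
  have hs₀δ : s₀ < δ := (half_lt_self hm).trans_le (min_le_left _ _)
  have hs₀1 : s₀ < 1 := (half_lt_self hm).trans_le (min_le_right _ _)
  have hC0 : 0 ≤ C := (abs_nonneg _).trans (hC 1 ⟨one_pos, le_rfl⟩)
  have hlim : Tendsto (fun s => (R₁ s - R₂ s) ^ 2 + (Y₁ s - Y₂ s) ^ 2) (𝓝[>] 0) (𝓝 0) := by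
    have := ((hR₁.sub hR₂).pow 2).add ((hY₁.sub hY₂).pow 2)
    simpa using this
  have mem₁ : ∀ s ∈ Ioc 0 s₀, s ∈ Ioo 0 M₁ := fun s hs => ⟨hs.1, by linarith [hs.2]⟩
  have mem₂ : ∀ s ∈ Ioc 0 s₀, s ∈ Ioo 0 M₂ := fun s hs => ⟨hs.1, by linarith [hs.2]⟩
  -- With s as variable only differences of 1/R and 1/Y occur, and f(s) is a common bounded factor.
  -- The constant comes from Y > α/2, giving 1/(Y₁Y₂) ≤ 4/α², and from R > a.
  have hzero := eq_zero_of_hasDerivAt_le_mul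
    (L := 4 / α ^ 2 + (k + 1) / a ^ 2 + 2 * (C * (4 / α ^ 2))) (b := s₀) hlim
    (fun s hs => (((hu.hasDerivAt_R s (mem₁ s hs)).sub (hv.hasDerivAt_R s (mem₂ s hs))).pow 2).add
      (((hu.hasDerivAt_Y s (mem₁ s hs)).sub (hv.hasDerivAt_Y s (mem₂ s hs))).pow 2))
    (fun s hs => by
      have hs' : s ∈ Ioc 0 s₀ := Ioo_subset_Ioc_self hs
      have hYs := hδY ⟨hs.1, hs.2.trans hs₀δ⟩
      have hy₁ : α / 2 < Y₁ s := hYs.1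
      have hy₂ : α / 2 < Y₂ s := hYs.2
      have hy₁0 : 0 < Y₁ s := (half_pos hα).trans hy₁
      have hy₂0 : 0 < Y₂ s := (half_pos hα).trans hy₂
      have hr₁ := haR₁ s (mem₁ s hs')
      have hr₂ := haR₂ s (mem₂ s hs')
      have hr₁0 := ha.trans hr₁
      have hr₂0 := ha.trans hr₂
      have hfs := hC s ⟨hs.1, hs.2.le.trans hs₀1.le⟩
      have hp : 1 / (Y₁ s * Y₂ s) ≤ 4 / α ^ 2 := by
        rw [div_le_div_iff₀ (by positivity) (by positivity)]
        nlinarith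
      have hq : 1 / (R₁ s * R₂ s) ≤ 1 / a ^ 2 := by
        rw [div_le_div_iff₀ (by positivity) (by positivity)]
        nlinarith
      have e : (2 : ℕ) * (R₁ - R₂) s ^ (2 - 1) * (1 / Y₁ s - 1 / Y₂ s) +
          (2 : ℕ) * (Y₁ - Y₂) s ^ (2 - 1) * (-(1 * ((k : ℝ) + 1)) / R₁ s - f s / Y₁ s -
            (-(1 * ((k : ℝ) + 1)) / R₂ s - f s / Y₂ s)) =
          2 * ((R₁ s - R₂ s) * (Y₁ s - Y₂ s)) * ((k + 1) * (1 / (R₁ s * R₂ s)) -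
            1 / (Y₁ s * Y₂ s)) + 2 * (f s * (1 / (Y₁ s * Y₂ s))) * (Y₁ s - Y₂ s) ^ 2 := by
        simp only [Pi.sub_apply]
        push_cast
        field_simp
        ring
      refine e.le.trans ?_
      set P := 1 / (Y₁ s * Y₂ s)
      set Q := 1 / (R₁ s * R₂ s)
      have hP0 : 0 < P := by positivity
      have hQ0 : 0 < Q := by positivity
      have hk : (0 : ℝ) ≤ k + 1 := by positivity
      have hc1 : |(k + 1) * Q - P| ≤ 4 / α ^ 2 + (k + 1) / a ^ 2 := by
        have h1 : (k + 1) * Q ≤ (k + 1) / a ^ 2 := by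
          rw [div_eq_mul_one_div ((k : ℝ) + 1)]
          gcongr
        have h2 : 0 ≤ (k + 1) * Q := by positivity
        rw [abs_le]
        constructor <;> linarith
      have hc2 : f s * P ≤ C * (4 / α ^ 2) := by
        have h1 := (le_abs_self (f s)).trans hfs
        calc f s * P ≤ C * P := by gcongr
          _ ≤ C * (4 / α ^ 2) := by gcongr
      exact quadratic_form_le hc1 hc2 (by positivity))
    (fun s _ => by positivity) hs₀
  refine ⟨s₀, ⟨hs₀, hs₀1⟩, ?_, ?_⟩
  · have : (R₁ s₀ - R₂ s₀) ^ 2 = 0 := by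
      nlinarith [sq_nonneg (R₁ s₀ - R₂ s₀), sq_nonneg (Y₁ s₀ - Y₂ s₀)]
    exact sub_eq_zero.1 (pow_eq_zero_iff two_ne_zero |>.1 this)
  · have : (Y₁ s₀ - Y₂ s₀) ^ 2 = 0 := by
      nlinarith [sq_nonneg (R₁ s₀ - R₂ s₀), sq_nonneg (Y₁ s₀ - Y₂ s₀)]
    exact sub_eq_zero.1 (pow_eq_zero_iff two_ne_zero |>.1 this)

/-- The conclusion of the comparison for the solution that decays first. -/
def DecaysAhead (I : Set ℝ) (w : ℝ → ℝ) : Prop :=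
  ∃ c > 0, ∃ x ∈ I, ∀ r ∈ I, x < r → r + c ∈ I ∧ c ≤ r * -w r

theorem IsBumpOf.decaysAhead {M₁ M₂ m₁ m₂ c s₁ : ℝ} {R₁ Y₁ R₁' Y₁' R₂ Y₂ R₂' Y₂' : ℝ → ℝ}
    (hu : IsPositiveRadial k f a I u w)
    (hv : IsPositiveRadial k f a I v z) (hbu : IsBumpOf a I u w M₁ m₁ R₁ Y₁ R₁' Y₁')
    (hbv : IsBumpOf a I v z M₂ m₂ R₂ Y₂ R₂' Y₂') (hc : 0 < c) (hs₁ : 0 < s₁) (hs₁M : s₁ < M₁)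
    (hs₁M₂ : s₁ < M₂)
    (h : ∀ s ∈ Ioo 0 s₁, R₂' s + c ≤ R₁' s ∧ c ≤ R₂' s * Y₂' s) : DecaysAhead I z := by
  have hs₁' : s₁ ∈ Ioo 0 M₂ := ⟨hs₁, hs₁M₂⟩
  -- The separation is applied at s = v r: then R₂' s = r, and r + c is at most R₁' s, a point of I.
  refine ⟨c, hc, R₂' s₁, hbv.R'_mem s₁ hs₁', fun r hr hlt => ?_⟩
  have hmr := (hbv.lt_R' s₁ hs₁').trans hlt
  have hvr := hbv.lt_of_peak_lt hv (hbv.lt_R' s₁ hs₁').le hlt hr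
  rw [hbv.u_R' s₁ hs₁'] at hvr
  have hs : v r ∈ Ioo 0 s₁ := ⟨hv.pos r hr, hvr⟩
  obtain ⟨h1, h2⟩ := h _ hs
  have hs₂ : v r ∈ Ioo 0 M₂ := ⟨hs.1, hs.2.trans hs₁M₂⟩
  rw [hbv.Y'_eq _ hs₂, hbv.R'_u hv hr hmr] at h2
  rw [hbv.R'_u hv hr hmr] at h1
  exact ⟨hu.left_subset _ (hbu.R'_mem _ ⟨hs.1, hs.2.trans hs₁M⟩)
    ⟨by linarith [hu.lt_of_mem r hr], h1⟩, h2⟩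

theorem IsPositiveRadial.eqOn_or_decaysAhead (hA : IsAdmissible k f F β)
    (hconv : ∀ x y, 1 ≤ x → x ≤ y → f x * (y - 1) ≤ f y * (x - 1))
    (hlip : ∀ ε A, 0 < ε → ∃ L, 0 ≤ L ∧ ∀ x ∈ Icc ε A, ∀ y ∈ Icc ε A, |f x - f y| ≤ L * |x - y|)
    {C : ℝ} (hC : ∀ s ∈ Ioc 0 1, |f s| ≤ C)
    (hu : IsPositiveRadial k f a I u w) (hv : IsPositiveRadial k f a I v z) :
    EqOn u v I ∨ DecaysAhead I w ∨ DecaysAhead I z := by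
  obtain ⟨M₁, m₁, α₁, R₁, Y₁, R₁', Y₁', hM₁, hbu, hu'⟩ := hu.exists_bump hA
  obtain ⟨M₂, m₂, α₂, R₂, Y₂, R₂', Y₂', hM₂, hbv, hv'⟩ := hv.exists_bump hA
  have hβ := hA.one_lt
  rcases lt_trichotomy α₁ α₂ with hα | hα | hα
  · obtain ⟨c, hc, s₁, hs, h1, h2, h3⟩ := hu'.separation hA hu.a_pos hv' hM₁ hM₂ hα
      (fun hM hR => hbu.not_forall_radius_lt hu hv hbv hconv (hβ.trans hM₁) hM hR)
    exact Or.inr (Or.inr (hbu.decaysAhead hu hv hbv hc hs h1 h2 h3))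
  · subst hα
    obtain ⟨s, hs, hR, hY⟩ := hu'.up.exists_eq_of_slope_eq hv'.up hu.a_pos hu'.slope_pos
      (hβ.trans hM₁) (hβ.trans hM₂) hC (fun s hs => (hbu.R_mem s hs).1)
      (fun s hs => (hbv.R_mem s hs).1) hu'.tendsto_R_zero hv'.tendsto_R_zero
      hu'.tendsto_Y_zero hv'.tendsto_Y_zero
    have h₁ : s ∈ Ioo 0 M₁ := ⟨hs.1, by linarith [hs.2]⟩
    have h₂ : s ∈ Ioo 0 M₂ := ⟨hs.1, by linarith [hs.2]⟩
    refine Or.inl (hu.eq_of_eq_at hv hlip (hbu.R_mem_I hu h₁) ?_ ?_)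
    · rw [hbu.u_R s h₁, hR, hbv.u_R s h₂]
    · rw [← hbu.Y_eq s h₁, hY, hR, hbv.Y_eq s h₂]
  · obtain ⟨c, hc, s₁, hs, h1, h2, h3⟩ := hv'.separation hA hu.a_pos hu' hM₂ hM₁ hα
      (fun hM hR => hbv.not_forall_radius_lt hv hu hbu hconv (hβ.trans hM₂) hM hR)
    exact Or.inr (Or.inl (hbv.decaysAhead hv hu hbu hc hs h1 h2 h3))

end Uniqueness

/-! ### The quadratic inequality -/

section Quadratic

variable {x y κ N : ℝ}

/-- The quadratic form behind `(F / f)' ≥ κ / N`. -/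
theorem pohozaev_quadratic_nonneg {t : ℝ} (hN : 0 < N) (hxy : y < x) (hα : 0 ≤ y * (N - κ * x))
    (hγ : 0 ≤ x * (N - κ * y))
    (h : N ≤ x * (N - κ * y) ∨ N * (1 + x - y) ^ 2 ≤ 4 * (x * (N - κ * y))) (ht : 0 ≤ t) :
    0 ≤ N * (x * y * (t - 1) ^ 2 - (y * t - x) * ((x - 1) * t - (y - 1))) -
      κ * (x * y) * (t - 1) ^ 2 := by
  obtain ⟨A, hA0, hA⟩ : ∃ A, 0 ≤ A ∧ A ^ 2 = y * (N - κ * x) :=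
    ⟨_, Real.sqrt_nonneg _, Real.sq_sqrt hα⟩
  obtain ⟨G, hG0, hG⟩ : ∃ G, 0 ≤ G ∧ G ^ 2 = x * (N - κ * y) :=
    ⟨_, Real.sqrt_nonneg _, Real.sq_sqrt hγ⟩
  obtain ⟨S, hS0, hS⟩ : ∃ S, 0 < S ∧ S ^ 2 = N :=
    ⟨_, Real.sqrt_pos.2 hN, Real.sq_sqrt hN.le⟩
  -- The form equals (At - G)² + (S²(x - y)² - (G - A)²)t, so G - A ≤ S(x - y) suffices. By this
  -- difference of squares that follows from S ≤ A + G.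
  have hdiff : G ^ 2 - A ^ 2 = S ^ 2 * (x - y) := by rw [hA, hG, hS]; ring
  have hsum : S ≤ A + G := by
    rcases h with h | h
    · have : S ^ 2 ≤ G ^ 2 := by rw [hS, hG]; exact h
      have := le_of_sq_le_sq this hG0
      linarith
    · rw [← hG, ← hS] at h
      have h1 : S * (1 + x - y) ≤ 2 * G := by
        refine le_of_sq_le_sq ?_ (by positivity)
        nlinarith
      have h2 : (S - G) ^ 2 ≤ A ^ 2 := by nlinarith
      have := le_of_sq_le_sq h2 hA0
      linarith
  have hGA : 0 ≤ G - A := by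
    by_contra hn
    have h1 : 0 < S ^ 2 * (x - y) := mul_pos (by positivity) (by linarith)
    nlinarith
  have hsq : (G - A) ^ 2 ≤ S ^ 2 * (x - y) ^ 2 := by
    have h1 : S * (G - A) ≤ S * (S * (x - y)) := by nlinarith
    have h2 : G - A ≤ S * (x - y) := le_of_mul_le_mul_left h1 hS0
    rw [← mul_pow]
    gcongr
  have e : N * (x * y * (t - 1) ^ 2 - (y * t - x) * ((x - 1) * t - (y - 1))) -
      κ * (x * y) * (t - 1) ^ 2 =
      (A * t - G) ^ 2 + (S ^ 2 * (x - y) ^ 2 - (G - A) ^ 2) * t := by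
    rw [hS]
    linear_combination (t - t ^ 2) * hA + (t - 1) * hG
  rw [e]
  have := mul_nonneg (sub_nonneg.2 hsq) ht
  positivity

/-- With d = x - y: for d ≥ 1 the first alternative holds. For d < 1 one has (1 + d)² ≤ 1 + 3d, and
the resulting inequality is affine in d, so it is checked at d = 0 and d = 1. -/
theorem pohozaev_condition_of_le (hκ : 0 ≤ κ) (hN : 2 * κ ≤ N) (hy : 1 < y) (hxy : y < x)
    (hκy : κ * (y + 1) ≤ N) :
    N ≤ x * (N - κ * y) ∨ N * (1 + x - y) ^ 2 ≤ 4 * (x * (N - κ * y)) := by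
  by_contra! hcon
  obtain ⟨h1, h2⟩ := hcon
  have hw : κ ≤ N - κ * y := by linarith
  have hd : x - y < 1 := by
    by_contra hn
    rw [not_lt] at hn
    have : (y + 1) * (N - κ * y) ≤ x * (N - κ * y) := by
      apply mul_le_mul_of_nonneg_right _ (by linarith)
      linarith
    nlinarith
  have e1 : 0 ≤ 4 * y * (N - κ * y) - N := by
    have := mul_nonneg (sub_nonneg.2 hy.le) (sub_nonneg.2 hκy)
    nlinarith
  have e2 : 0 ≤ 4 * (y + 1) * (N - κ * y) - 4 * N := by nlinarith
  have e3 := mul_nonneg (sub_nonneg.2 hd.le) e1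
  have e4 := mul_nonneg (sub_nonneg.2 hxy.le) e2
  have e5 : (1 + x - y) ^ 2 ≤ 1 + 3 * (x - y) := by nlinarith
  have e6 : N * (1 + x - y) ^ 2 ≤ N * (1 + 3 * (x - y)) :=
    mul_le_mul_of_nonneg_left e5 (by linarith)
  nlinarith

/-- With x = p + 1 this is subcriticality, p ≤ (n+2)/(n-2), a consequence of p ≤ P(q). In X = κx - N
and W = N - κy the hypothesis bounds N(κ - W)² + X(2N(κ + W) - 4κW) + NX² by 0, which fails for X >
0. -/
theorem mul_le_of_pohozaev_condition (hκ : 0 < κ) (hN : 2 * κ < N)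
    (hκy : κ * y < N) (h : N * (1 + x - y) ^ 2 ≤ 4 * (x * (N - κ * y))) : κ * x ≤ N := by
  by_contra hn
  rw [not_le] at hn
  obtain ⟨X, hX⟩ : ∃ X, X = κ * x - N := ⟨_, rfl⟩
  obtain ⟨W, hW⟩ : ∃ W, W = N - κ * y := ⟨_, rfl⟩
  have hX0 : 0 < X := by linarith
  have hW0 : 0 < W := by linarith
  have h1 : N * (κ + X + W) ^ 2 ≤ 4 * κ * ((N + X) * W) := by
    have := mul_le_mul_of_nonneg_left h (sq_nonneg κ)
    rw [hX, hW]
    nlinarith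
  have h2 : 0 ≤ N * (κ - W) ^ 2 := by
    have : 0 < N := by linarith
    positivity
  have h3 : 0 < X * (2 * N * (κ + W) - 4 * κ * W) := by
    apply mul_pos hX0
    nlinarith [mul_pos hκ hW0, mul_pos hκ hκ]
  have h4 : 0 < N * X ^ 2 := by
    have : 0 < N := by linarith
    positivity
  nlinarith

end Quadratic

/-! ### The nonlinearity s^p - s^q -/

section PowerDiff

variable {p q : ℝ}

/-- The primitive of `powerDiff p q` vanishing at `0`. -/
noncomputable def powerDiffPrimitive (p q s : ℝ) : ℝ := s ^ (p + 1) / (p + 1) - s ^ (q + 1) / (q + 1)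

theorem powerDiff_eq {s : ℝ} (hs : 0 < s) : powerDiff p q s = s ^ q * (s ^ (p - q) - 1) := by
  rw [powerDiff, mul_sub, ← Real.rpow_add hs, mul_one]
  congr 2
  ring

theorem powerDiffPrimitive_eq {s : ℝ} (hs : 0 < s) :
    powerDiffPrimitive p q s = s ^ q * s * (s ^ (p - q) / (p + 1) - 1 / (q + 1)) := by
  have h1 : s ^ (p + 1) = s ^ q * s * s ^ (p - q) := by
    rw [← Real.rpow_add_one hs.ne', ← Real.rpow_add hs]
    congr 1
    ring
  rw [powerDiffPrimitive, h1, Real.rpow_add_one hs.ne']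
  ring

theorem hasDerivAt_powerDiff {s : ℝ} (hs : 0 < s) :
    HasDerivAt (powerDiff p q) (p * s ^ (p - 1) - q * s ^ (q - 1)) s :=
  (Real.hasDerivAt_rpow_const (Or.inl hs.ne')).sub (Real.hasDerivAt_rpow_const (Or.inl hs.ne'))

theorem powerDiff_deriv_eq {s : ℝ} (hs : 0 < s) :
    p * s ^ (p - 1) - q * s ^ (q - 1) = s ^ q / s * (p * s ^ (p - q) - q) := by
  have h1 : s ^ (p - 1) = s ^ q / s * s ^ (p - q) := by
    rw [← Real.rpow_sub_one hs.ne', ← Real.rpow_add hs]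
    congr 1
    ring
  rw [h1, Real.rpow_sub_one hs.ne']
  ring

theorem hasDerivAt_powerDiffPrimitive (hp : 0 < p) (hq : 0 < q) {s : ℝ} (hs : 0 < s) :
    HasDerivAt (powerDiffPrimitive p q) (powerDiff p q s) s := by
  have h1 : p + 1 ≠ 0 := by positivity
  have h2 : q + 1 ≠ 0 := by positivity
  refine (((Real.hasDerivAt_rpow_const (p := p + 1) (Or.inl hs.ne')).div_const (p + 1)).sub
    ((Real.hasDerivAt_rpow_const (p := q + 1) (Or.inl hs.ne')).div_const (q + 1))).congr_deriv ?_
  rw [powerDiff, add_sub_cancel_right, add_sub_cancel_right]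
  field_simp

/-- The nonlinearity `s ^ p - s ^ q` is admissible if the quadratic condition holds. -/
theorem isAdmissible_powerDiff {k : ℕ} (hq : 0 < q) (hqp : q < p)
    (hquad : ∀ t : ℝ, 0 ≤ t → 0 ≤ 2 * ((k : ℝ) + 2) * ((p + 1) * (q + 1) * (t - 1) ^ 2 -
      ((q + 1) * t - (p + 1)) * (p * t - q)) - k * ((p + 1) * (q + 1)) * (t - 1) ^ 2) :
    IsAdmissible k (powerDiff p q) (powerDiffPrimitive p q)
      (((p + 1) / (q + 1)) ^ (p - q)⁻¹) := by
  have hp : 0 < p := hq.trans hqp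
  have hpq : 0 < p - q := sub_pos.2 hqp
  have hτ : 1 < (p + 1) / (q + 1) := by
    rw [one_lt_div (by positivity)]
    linarith
  set β := ((p + 1) / (q + 1)) ^ (p - q)⁻¹ with hβdef
  have hβ1 : 1 < β := Real.one_lt_rpow hτ (inv_pos.2 hpq)
  have hβ0 : 0 < β := by linarith
  have hβpow : β ^ (p - q) = (p + 1) / (q + 1) :=
    Real.rpow_inv_rpow (by positivity) hpq.ne'
  have hsgn : ∀ t : ℝ, t / (p + 1) - 1 / (q + 1) = (t - (p + 1) / (q + 1)) / (p + 1) := by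
    intro t
    field_simp
  refine ⟨hβ1, fun s hs => hasDerivAt_powerDiffPrimitive hp hq hs, ?_, fun s hs => ?_, ?_,
    fun s hs => ?_, fun s hs => ?_, fun s hs => ?_, fun s hs => ?_⟩
  · have hc : ContinuousAt (powerDiffPrimitive p q) 0 :=
      ((Real.continuousAt_rpow_const 0 (p + 1) (Or.inr (by linarith))).div_const _).sub
        ((Real.continuousAt_rpow_const 0 (q + 1) (Or.inr (by linarith))).div_const _)
    have h0 : powerDiffPrimitive p q 0 = 0 := by
      simp [powerDiffPrimitive, Real.zero_rpow (show p + 1 ≠ 0 by positivity),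
        Real.zero_rpow (show q + 1 ≠ 0 by positivity)]
    have := hc.tendsto.mono_left (nhdsWithin_le_nhds (s := Ioi 0))
    rwa [h0] at this
  · rw [powerDiffPrimitive_eq hs.1, hsgn, ← hβpow]
    have h1 : s ^ (p - q) ≤ β ^ (p - q) := Real.rpow_le_rpow hs.1.le hs.2 hpq.le
    have h2 := Real.rpow_pos_of_pos hs.1 q
    exact mul_nonpos_of_nonneg_of_nonpos (mul_nonneg h2.le hs.1.le)
      (div_nonpos_of_nonpos_of_nonneg (by linarith) (by linarith))
  · rw [powerDiffPrimitive_eq hβ0, hsgn, hβpow]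
    simp
  · have hs0 := hβ0.trans hs
    rw [powerDiffPrimitive_eq hs0, hsgn, ← hβpow]
    have h1 : β ^ (p - q) < s ^ (p - q) := Real.rpow_lt_rpow hβ0.le hs hpq
    have h2 := Real.rpow_pos_of_pos hs0 q
    exact mul_pos (mul_pos h2 hs0) (div_pos (by linarith) (by linarith))
  · rw [powerDiff_eq hs.1]
    have h1 := Real.rpow_le_one hs.1.le hs.2 hpq.le
    have h2 := Real.rpow_pos_of_pos hs.1 q
    exact mul_nonpos_of_nonneg_of_nonpos h2.le (by linarith)
  · have hs0 : 0 < s := by linarith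
    rw [powerDiff_eq hs0]
    have h1 := Real.one_lt_rpow hs hpq
    have h2 := Real.rpow_pos_of_pos hs0 q
    exact mul_pos h2 (by linarith)
  · have hs0 : 0 < s := by linarith
    have ht1 := Real.one_lt_rpow hs hpq
    have h2 := Real.rpow_pos_of_pos hs0 q
    have hf : powerDiff p q s ≠ 0 := by
      rw [powerDiff_eq hs0]
      exact (mul_pos h2 (by linarith)).ne'
    refine ⟨_, (hasDerivAt_powerDiffPrimitive hp hq hs0).div (hasDerivAt_powerDiff hs0) hf, ?_⟩
    rw [powerDiff_deriv_eq hs0, powerDiffPrimitive_eq hs0, powerDiff_eq hs0]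
    -- After factoring out powers of s, the bound on (F/f)' depends on s only through t = s^(p-q).
    have hq2 := hquad (s ^ (p - q)) (by linarith)
    generalize s ^ (p - q) = t at *
    generalize s ^ q = z at *
    have ht : 0 < t - 1 := by linarith
    have e : 2 * ((k : ℝ) + 2) * ((z * (t - 1) * (z * (t - 1)) -
        z * s * (t / (p + 1) - 1 / (q + 1)) * (z / s * (p * t - q))) / (z * (t - 1)) ^ 2) - k =
        (2 * ((k : ℝ) + 2) * ((p + 1) * (q + 1) * (t - 1) ^ 2 -
          ((q + 1) * t - (p + 1)) * (p * t - q)) - k * ((p + 1) * (q + 1)) * (t - 1) ^ 2) /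
          ((p + 1) * (q + 1) * (t - 1) ^ 2) := by
      field_simp
    have h3 : 0 ≤ (2 * ((k : ℝ) + 2) * ((p + 1) * (q + 1) * (t - 1) ^ 2 -
          ((q + 1) * t - (p + 1)) * (p * t - q)) - k * ((p + 1) * (q + 1)) * (t - 1) ^ 2) /
          ((p + 1) * (q + 1) * (t - 1) ^ 2) := div_nonneg hq2 (by positivity)
    linarith

/-- For q ≤ 1 both terms are nondecreasing. For q ≥ 1 the derivative is s^(q-1)(p s^(p-q) - q), a
product of nonnegative nondecreasing factors on s ≥ 1. -/
theorem powerDiff_deriv_mono (hq : 0 < q) (hqp : q < p) (hp : 1 < p) {s t : ℝ} (hs : 1 ≤ s)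
    (hst : s ≤ t) : p * s ^ (p - 1) - q * s ^ (q - 1) ≤ p * t ^ (p - 1) - q * t ^ (q - 1) := by
  have hs0 : 0 < s := by linarith
  have ht0 : 0 < t := by linarith
  rcases le_total q 1 with h | h
  · have h1 : s ^ (p - 1) ≤ t ^ (p - 1) := Real.rpow_le_rpow hs0.le hst (by linarith)
    have h2 : t ^ (q - 1) ≤ s ^ (q - 1) := Real.rpow_le_rpow_of_nonpos hs0 hst (by linarith)
    nlinarith
  · rw [powerDiff_deriv_eq hs0, powerDiff_deriv_eq ht0, ← Real.rpow_sub_one hs0.ne',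
      ← Real.rpow_sub_one ht0.ne']
    have h1 : s ^ (q - 1) ≤ t ^ (q - 1) := Real.rpow_le_rpow hs0.le hst (by linarith)
    have h2 : s ^ (p - q) ≤ t ^ (p - q) := Real.rpow_le_rpow hs0.le hst (by linarith)
    have h3 := Real.one_le_rpow hs (show 0 ≤ p - q by linarith)
    have h4 := Real.rpow_pos_of_pos ht0 (q - 1)
    have h5 : 0 ≤ p * s ^ (p - q) - q := by nlinarith
    have h6 : p * s ^ (p - q) - q ≤ p * t ^ (p - q) - q := by nlinarith
    exact mul_le_mul h1 h6 h5 h4.le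

/-- Since f(1) = 0 and f is convex on [1, ∞), the secant slope f(s)/(s - 1) is nondecreasing. The
product form also covers x = 1. -/
theorem powerDiff_slope_mono (hq : 0 < q) (hqp : q < p) (hp : 1 < p) {x y : ℝ} (hx : 1 ≤ x)
    (hxy : x ≤ y) : powerDiff p q x * (y - 1) ≤ powerDiff p q y * (x - 1) := by
  have h1 : powerDiff p q 1 = 0 := by simp [powerDiff]
  have htan : powerDiff p q x ≤ (p * x ^ (p - 1) - q * x ^ (q - 1)) * (x - 1) := by
    have := le_of_hasDerivAt_nonneg
      (φ := fun t => (p * x ^ (p - 1) - q * x ^ (q - 1)) * (t - 1) - powerDiff p q t) hx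
      (fun t ht => (((hasDerivAt_id t).sub_const 1).const_mul _).sub
        (hasDerivAt_powerDiff (by linarith [ht.1])))
      (fun t ht => by
        have := powerDiff_deriv_mono hq hqp hp ht.1.le ht.2.le
        linarith)
    simp only [sub_self, mul_zero, h1] at this
    linarith
  have := le_of_hasDerivAt_nonneg
    (φ := fun t => powerDiff p q t * (x - 1) - powerDiff p q x * (t - 1)) hxy
    (fun t ht => ((hasDerivAt_powerDiff (by linarith [ht.1])).mul_const _).sub
      (((hasDerivAt_id t).sub_const 1).const_mul _))
    (fun t ht => by
      have h2 := powerDiff_deriv_mono hq hqp hp hx ht.1.le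
      have h3 := mul_le_mul_of_nonneg_right h2 (sub_nonneg.2 hx)
      linarith)
  simp only [sub_self] at this
  linarith

theorem exists_lipschitz_powerDiff (ε A : ℝ) (hε : 0 < ε) :
    ∃ L, 0 ≤ L ∧ ∀ x ∈ Icc ε A, ∀ y ∈ Icc ε A,
      |powerDiff p q x - powerDiff p q y| ≤ L * |x - y| := by
  have hc : ContinuousOn (fun s : ℝ => p * s ^ (p - 1) - q * s ^ (q - 1)) (Icc ε A) := by
    intro s hs
    have hs0 : s ≠ 0 := (hε.trans_le hs.1).ne'
    exact (((Real.continuousAt_rpow_const s (p - 1) (Or.inl hs0)).const_mul p).sub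
      ((Real.continuousAt_rpow_const s (q - 1) (Or.inl hs0)).const_mul q)).continuousWithinAt
  obtain ⟨L, hL⟩ := isCompact_Icc.exists_bound_of_continuousOn hc
  refine ⟨max L 0, le_max_right _ _, fun x hx y hy => ?_⟩
  exact (convex_Icc ε A).norm_image_sub_le_of_norm_hasDerivWithin_le
    (fun s hs => (hasDerivAt_powerDiff (hε.trans_le hs.1)).hasDerivWithinAt)
    (fun s hs => (hL s hs).trans (le_max_left _ _)) hy hx

theorem abs_powerDiff_le_one (hp : 0 ≤ p) (hq : 0 ≤ q) {s : ℝ} (hs : s ∈ Ioc 0 1) :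
    |powerDiff p q s| ≤ 1 := by
  have h1 := Real.rpow_pos_of_pos hs.1 p
  have h2 := Real.rpow_pos_of_pos hs.1 q
  have h3 := Real.rpow_le_one hs.1.le hs.2 hp
  have h4 := Real.rpow_le_one hs.1.le hs.2 hq
  rw [powerDiff, abs_le]
  constructor <;> linarith

/-- For `q < 1` a solution with positive energy reaches `0` at a finite radius. -/
theorem IsPositiveRadial.not_exterior_of_lt_one {k : ℕ} {a β : ℝ} {u w : ℝ → ℝ}
    (hA : IsAdmissible k (powerDiff p q) (powerDiffPrimitive p q) β) (hq : 0 < q) (hqp : q < p)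
    (hq1 : q < 1) : ¬ IsPositiveRadial k (powerDiff p q) a (Ioi a) u w := by
  intro hu
  obtain ⟨M, m, α, R, Y, R', Y', hM, hb, hB⟩ := hu.exists_bump hA
  have hp : 0 < p := hq.trans hqp
  have hM1 : 1 < M := hA.one_lt.trans hM
  set κ := 2 * (1 / (q + 1) - 1 / (p + 1)) with hκ
  have hκ0 : 0 < κ := by
    have : 1 / (p + 1) < 1 / (q + 1) := one_div_lt_one_div_of_lt (by linarith) (by linarith)
    rw [hκ]
    linarith
  set e := (1 - q) / 2 with he
  have he0 : 0 < e := by rw [he]; linarith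
  -- Positive energy gives Y'² > -2F(s) ≥ κ s^(q+1) on (0, 1].
  have hY : ∀ s ∈ Ioc 0 1, √κ * s ^ ((q + 1) / 2) ≤ Y' s := by
    intro s hs
    have hsM : s ∈ Ioo 0 M := ⟨hs.1, hs.2.trans_lt hM1⟩
    have h1 := hB.energy_down s hsM
    simp only [branchEnergy] at h1
    refine le_of_sq_le_sq ?_ (hB.down.Y_pos s hsM).le
    rw [mul_pow, Real.sq_sqrt hκ0.le, ← Real.rpow_mul_natCast hs.1.le,
      show (q + 1) / 2 * ((2 : ℕ) : ℝ) = q + 1 by push_cast; ring, Real.rpow_add_one hs.1.ne']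
    rw [powerDiffPrimitive_eq hs.1] at h1
    have h2 := Real.rpow_le_one hs.1.le hs.2 (sub_nonneg.2 hqp.le)
    have h3 : s ^ (p - q) / (p + 1) ≤ 1 / (p + 1) := by gcongr
    have h4 : 0 < s ^ q * s := mul_pos (Real.rpow_pos_of_pos hs.1 q) hs.1
    rw [hκ]
    nlinarith
  -- For q < 1 the bound on 1/Y' is a multiple of s^(e-1) with e > 0, hence integrable at 0, and the
  -- radius stays bounded.
  have hbound : ∀ s ∈ Ioc 0 1, R' s ≤ R' 1 + 1 / √κ * (1 / e) := by
    intro s hs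
    have hsq := Real.sqrt_pos.2 hκ0
    have := le_of_hasDerivAt_nonneg (φ := fun s => R' s + 1 / √κ * (s ^ e / e)) hs.2
      (fun t ht => (hB.down.hasDerivAt_R t ⟨hs.1.trans_le ht.1, ht.2.trans_lt hM1⟩).add
        (((Real.hasDerivAt_rpow_const (p := e)
          (Or.inl (hs.1.trans_le ht.1).ne')).div_const e).const_mul (1 / √κ)))
      (fun t ht => by
        have ht0 := hs.1.trans ht.1
        have hYt := hY t ⟨ht0, ht.2.le⟩
        have hpw := Real.rpow_pos_of_pos ht0 ((q + 1) / 2)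
        have h1 : 1 / Y' t ≤ 1 / (√κ * t ^ ((q + 1) / 2)) :=
          one_div_le_one_div_of_le (by positivity) hYt
        have h2 : t ^ (e - 1) = 1 / t ^ ((q + 1) / 2) := by
          rw [show e - 1 = -((q + 1) / 2) by rw [he]; ring, Real.rpow_neg ht0.le, one_div]
        have h3 : 1 / √κ * (e * t ^ (e - 1) / e) = 1 / (√κ * t ^ ((q + 1) / 2)) := by
          rw [h2]
          field_simp
        rw [h3, neg_div]
        linarith)
    have h4 := Real.rpow_pos_of_pos hs.1 e
    have h5 : 0 ≤ 1 / √κ * (s ^ e / e) := by positivity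
    rw [Real.one_rpow] at this
    linarith
  obtain ⟨r₀, -, hr₀⟩ := hu.right 1 one_pos
  set r := max (max r₀ m) (R' 1 + 1 / √κ * (1 / e)) + 1
  have hr1 : r₀ < r := by
    linarith [(le_max_left r₀ m).trans (le_max_left _ (R' 1 + 1 / √κ * (1 / e)))]
  have hr2 : m < r := by
    linarith [(le_max_right r₀ m).trans (le_max_left _ (R' 1 + 1 / √κ * (1 / e)))]
  have hr3 : R' 1 + 1 / √κ * (1 / e) < r := by
    linarith [le_max_right (max r₀ m) (R' 1 + 1 / √κ * (1 / e))]
  have hrI : r ∈ Ioi a := lt_trans hb.peak_mem hr2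
  have := hbound (u r) ⟨hu.pos r hrI, (hr₀ r hrI hr1).le⟩
  rw [hb.R'_u hu hrI hr2] at this
  linarith

end PowerDiff

/-! ### Annuli and exterior domains -/

section Domains

variable {k : ℕ} {f : ℝ → ℝ} {a b : ℝ} {u w : ℝ → ℝ}

/-- Points closer to b than c cannot be shifted by c inside the interval. -/
theorem not_decaysAhead_Ioo : ¬ DecaysAhead (Ioo a b) w := by
  rintro ⟨c, hc, x, hx, h⟩
  have h1 : x < max ((x + b) / 2) (b - c) := lt_max_of_lt_left (by linarith [hx.2])
  have h2 : max ((x + b) / 2) (b - c) < b := max_lt (by linarith [hx.2]) (by linarith)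
  have := (h _ ⟨hx.1.trans h1, h2⟩ h1).1.2
  linarith [le_max_right ((x + b) / 2) (b - c)]

/-- The bound r|u'| ≥ c makes u + c log r nonincreasing, so u would become negative. -/
theorem IsPositiveRadial.not_decaysAhead (hu : IsPositiveRadial k f a (Ioi a) u w) :
    ¬ DecaysAhead (Ioi a) w := by
  rintro ⟨c, hc, x, hx, h⟩
  have hx' : a < x := hx
  have hx0 : 0 < x := hu.a_pos.trans hx'
  have hlog : ∀ r, x ≤ r → u r + c * Real.log r ≤ u x + c * Real.log x := fun r hr =>
    le_of_hasDerivAt_nonpos (φ := fun r => u r + c * Real.log r) hr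
      (fun t ht => (hu.hasDerivAt_u t (hx'.trans_le ht.1)).add
        ((Real.hasDerivAt_log (hx0.trans_le ht.1).ne').const_mul c))
      (fun t ht => by
        have h1 := (h t (hx'.trans ht.1) ht.1).2
        have ht0 : 0 < t := hx0.trans ht.1
        have h2 : c * t⁻¹ ≤ -w t := by
          rw [← div_eq_mul_inv, div_le_iff₀ ht0]
          linarith
        linarith)
  have hT : Tendsto (fun r => c * Real.log r) atTop atTop := Real.tendsto_log_atTop.const_mul_atTop hc
  obtain ⟨r, hr1, hr2⟩ := ((hT.eventually_gt_atTop (u x + c * Real.log x)).and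
    (eventually_ge_atTop x)).exists
  have h1 := hlog r hr2
  have h2 := hu.pos r (hx'.trans_le hr2)
  linarith

theorem IsPositiveExteriorSolution.isPositiveRadial (ha : 0 < a)
    (hu : IsPositiveExteriorSolution (k + 2) f a u) :
    IsPositiveRadial k f a (Ioi a) u (deriv u) where
  a_pos := ha
  nonempty := ⟨a + 1, by simp⟩
  lt_of_mem _ hr := hr
  left_subset _ _ _ hx := hx.1
  exists_gt r hr := ⟨r + 1, lt_trans hr (lt_add_one r), lt_add_one r⟩
  hasDerivAt_u r hr := (hu.solves.differentiable r hr).hasDerivAt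
  hasDerivAt_w r hr := by
    refine (hu.solves.twice_differentiable r hr).hasDerivAt.congr_deriv ?_
    have := hu.solves.equation r hr
    push_cast at this
    linear_combination this
  pos := hu.pos
  left := by
    have := (hu.continuousOn a self_mem_Ici).tendsto.mono_left
      (nhdsWithin_mono a Ioi_subset_Ici_self)
    rwa [hu.left] at this
  right ε hε := by
    obtain ⟨r₀, h⟩ := eventually_atTop.1 (hu.decay.eventually (gt_mem_nhds hε))
    exact ⟨max r₀ (a + 1), lt_max_of_lt_right (lt_add_one a),
      fun r _ hr => h r ((le_max_left _ _).trans hr.le)⟩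

theorem IsPositiveAnnulusSolution.isPositiveRadial (ha : 0 < a) (hab : a < b)
    (hu : IsPositiveAnnulusSolution (k + 2) f a b u) :
    IsPositiveRadial k f a (Ioo a b) u (deriv u) where
  a_pos := ha
  nonempty := nonempty_Ioo.2 hab
  lt_of_mem _ hr := hr.1
  left_subset _ hr _ hx := ⟨hx.1, hx.2.trans_lt hr.2⟩
  exists_gt r hr := by
    obtain ⟨x, h1, h2⟩ := exists_between hr.2
    exact ⟨x, ⟨hr.1.trans h1, h2⟩, h1⟩
  hasDerivAt_u r hr := (hu.solves.differentiable r hr).hasDerivAt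
  hasDerivAt_w r hr := by
    refine (hu.solves.twice_differentiable r hr).hasDerivAt.congr_deriv ?_
    have := hu.solves.equation r hr
    push_cast at this
    linear_combination this
  pos := hu.pos
  left := by
    have := (hu.continuousOn a (left_mem_Icc.2 hab.le)).tendsto.mono_left
      (nhdsWithin_le_iff.2 (by
        filter_upwards [Ioo_mem_nhdsGT hab] with x hx using Ioo_subset_Icc_self hx) :
        𝓝[>] a ≤ 𝓝[Icc a b] a)
    rwa [hu.left] at this
  right ε hε := by
    have := (hu.continuousOn b (right_mem_Icc.2 hab.le)).tendsto.mono_left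
      (nhdsWithin_le_iff.2 (by
        filter_upwards [Ioo_mem_nhdsLT hab] with x hx using Ioo_subset_Icc_self hx) :
        𝓝[<] b ≤ 𝓝[Icc a b] b)
    rw [hu.right] at this
    obtain ⟨x, hx, hxs⟩ := (mem_nhdsLT_iff_exists_Ioo_subset).1
      (this.eventually (gt_mem_nhds hε))
    have hxb : x < b := hx
    have h1 : max x a < b := max_lt hxb hab
    obtain ⟨y, hy1, hy2⟩ := exists_between h1
    exact ⟨y, ⟨(le_max_right _ _).trans_lt hy1, hy2⟩,
      fun r hr hyr => hxs ⟨(le_max_left _ _).trans_lt (hy1.trans hyr), hr.2⟩⟩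

end Domains

/-! ### The parameter ranges and the conclusion -/

/-- The parameter ranges guarantee the quadratic condition behind `(F / f)' ≥ (n - 2) / (2 n)`. -/
theorem pohozaev_quadratic_of_range {k : ℕ} {p q : ℝ} (hq : 0 < q) (hqp : q < p)
    (h : (0 < k ∧ q ≤ 4 / (k : ℝ) ∧ p ≤ ((k : ℝ) + 4) / k) ∨
      (0 < k ∧ 4 / (k : ℝ) < q ∧
        q < (4 + √(2 * ((k : ℝ) + 2) * ((k : ℝ) + 4))) / (2 * k) ∧
        ((k : ℝ) + 2) * p ≤ 2 * (q + 1) + √(((k : ℝ) + 4) * (q + 1) * ((k : ℝ) + 4 - k * q))) ∨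
      k = 0) {t : ℝ} (ht : 0 ≤ t) :
    0 ≤ 2 * ((k : ℝ) + 2) * ((p + 1) * (q + 1) * (t - 1) ^ 2 -
      ((q + 1) * t - (p + 1)) * (p * t - q)) - k * ((p + 1) * (q + 1)) * (t - 1) ^ 2 := by
  have hp : 0 < p := hq.trans hqp
  have hk0 : (0 : ℝ) ≤ k := Nat.cast_nonneg k
  have key : (k : ℝ) * (p + 1) ≤ 2 * (k + 2) ∧
      (2 * ((k : ℝ) + 2) ≤ (p + 1) * (2 * (k + 2) - k * (q + 1)) ∨
      2 * ((k : ℝ) + 2) * (1 + (p + 1) - (q + 1)) ^ 2 ≤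
        4 * ((p + 1) * (2 * (k + 2) - k * (q + 1)))) := by
    rcases h with ⟨hk, hq4, hp4⟩ | ⟨hk, hq4, hq5, hp4⟩ | rfl
    · have hk' : (0 : ℝ) < k := by exact_mod_cast hk
      rw [le_div_iff₀ hk'] at hq4 hp4
      exact ⟨by linarith, pohozaev_condition_of_le hk0 (by linarith) (by linarith) (by linarith)
        (by linarith)⟩
    · have hk' : (0 : ℝ) < k := by exact_mod_cast hk
      rw [div_lt_iff₀ hk'] at hq4
      rw [lt_div_iff₀ (by positivity)] at hq5
      -- The upper bound on q serves to give kq < k + 4, so that the radicand in P(q) is nonnegative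
      -- and p ≤ P(q) can be squared.
      have hs : √(2 * ((k : ℝ) + 2) * ((k : ℝ) + 4)) ≤ 2 * (k + 2) := by
        refine Real.sqrt_le_iff.2 ⟨by positivity, ?_⟩
        nlinarith
      have hw : (k : ℝ) * q < k + 4 := by linarith
      have hrad : 0 ≤ ((k : ℝ) + 4) * (q + 1) * ((k : ℝ) + 4 - k * q) := by
        have : 0 ≤ (k : ℝ) + 4 - k * q := by linarith
        positivity
      have hkp : (k : ℝ) * q < k * p := by gcongr
      have hsq : (((k : ℝ) + 2) * p - 2 * (q + 1)) ^ 2 ≤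
          ((k : ℝ) + 4) * (q + 1) * ((k : ℝ) + 4 - k * q) := by
        rw [← Real.sq_sqrt hrad]
        have h1 : ((k : ℝ) + 2) * p - 2 * (q + 1) ≤
            √(((k : ℝ) + 4) * (q + 1) * ((k : ℝ) + 4 - k * q)) := by linarith
        have h2 : 0 ≤ ((k : ℝ) + 2) * p - 2 * (q + 1) := by nlinarith
        gcongr
      have hcond : 2 * ((k : ℝ) + 2) * (1 + (p + 1) - (q + 1)) ^ 2 ≤
          4 * ((p + 1) * (2 * (k + 2) - k * (q + 1))) := by
        have h2 : (0 : ℝ) < k + 2 := by positivity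
        refine le_of_mul_le_mul_left ?_ h2
        linarith
      exact ⟨mul_le_of_pohozaev_condition (y := q + 1) hk' (by linarith)
        (by linarith) hcond, Or.inr hcond⟩
    · refine ⟨by norm_num, ?_⟩
      exact pohozaev_condition_of_le hk0 (by linarith) (by linarith) (by linarith)
        (by norm_num)
  have hkq : (k : ℝ) * (q + 1) ≤ 2 * (k + 2) := by
    have : (k : ℝ) * (q + 1) ≤ k * (p + 1) := by gcongr
    linarith [key.1]
  have := pohozaev_quadratic_nonneg (x := p + 1) (y := q + 1) (κ := k) (N := 2 * ((k : ℝ) + 2))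
    (by positivity) (by linarith) (mul_nonneg (by linarith) (by linarith [key.1]))
    (mul_nonneg (by linarith) (by linarith)) key.2 ht
  simpa only [add_sub_cancel_right] using this

theorem corollary1p4 (n : ℕ) (hn : 2 ≤ n) (p q : ℝ) (hq : 0 < q) (hqp : q < p)
    (h : (2 < n ∧ q ≤ 4 / ((n : ℝ) - 2) ∧ p ≤ ((n : ℝ) + 2) / ((n : ℝ) - 2)) ∨
      (2 < n ∧ 4 / ((n : ℝ) - 2) < q ∧
        q < (4 + √(2 * (n : ℝ) * ((n : ℝ) + 2))) / (2 * ((n : ℝ) - 2)) ∧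
        p ≤ criticalP n q) ∨
      n = 2) :
    (∀ a : ℝ, 0 < a → ∀ u v : ℝ → ℝ,
      IsPositiveExteriorSolution n (powerDiff p q) a u →
      IsPositiveExteriorSolution n (powerDiff p q) a v →
      EqOn u v (Ici a)) ∧
    (1 < p → ∀ a b : ℝ, 0 < a → a < b → ∀ u v : ℝ → ℝ,
      IsPositiveAnnulusSolution n (powerDiff p q) a b u →
      IsPositiveAnnulusSolution n (powerDiff p q) a b v →
      EqOn u v (Icc a b)) := by
  obtain ⟨k, rfl⟩ := Nat.exists_eq_add_of_le' hn
  have hA := isAdmissible_powerDiff (k := k) hq hqp fun t ht =>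
    pohozaev_quadratic_of_range hq hqp (by
      have e1 : ((k + 2 : ℕ) : ℝ) = (k : ℝ) + 2 := by push_cast; ring
      have e2 : (k : ℝ) + 2 + 2 = k + 4 := by ring
      simp only [criticalP, e1, add_sub_cancel_right, e2] at h
      refine h.imp (fun h => ⟨by omega, h.2⟩) (Or.imp (fun h => ⟨by omega, h.2.1, h.2.2.1, ?_⟩)
        (fun h => by omega))
      have h2 : (0 : ℝ) < k + 2 := by positivity
      have h3 := h.2.2.2
      rw [le_div_iff₀ h2] at h3
      linarith) ht
  have hp0 : 0 < p := hq.trans hqp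
  have hmain : 1 < p → ∀ {a : ℝ} {I : Set ℝ} {u v w z : ℝ → ℝ},
      IsPositiveRadial k (powerDiff p q) a I u w → IsPositiveRadial k (powerDiff p q) a I v z →
      EqOn u v I ∨ DecaysAhead I w ∨ DecaysAhead I z := fun hp _ _ _ _ _ _ hu hv =>
    hu.eqOn_or_decaysAhead hA (fun x y hx hxy => powerDiff_slope_mono hq hqp hp hx hxy)
      exists_lipschitz_powerDiff (fun s hs => abs_powerDiff_le_one hp0.le hq.le hs) hv
  constructor
  · intro a ha u v hu hv r hr
    have hu' := hu.isPositiveRadial ha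
    have hv' := hv.isPositiveRadial ha
    -- The existence of an exterior solution forces q ≥ 1, hence p > 1, as the comparison requires.
    have hq1 : 1 ≤ q := by
      by_contra hn
      exact IsPositiveRadial.not_exterior_of_lt_one hA hq hqp (not_le.1 hn) hu'
    rcases eq_or_lt_of_le (mem_Ici.1 hr) with rfl | har
    · rw [hu.left, hv.left]
    · exact ((hmain (hq1.trans_lt hqp) hu' hv').resolve_right
        (not_or.2 ⟨hu'.not_decaysAhead, hv'.not_decaysAhead⟩)) har
  · intro hp a b ha hab u v hu hv r hr
    have heq := (hmain hp (hu.isPositiveRadial ha hab) (hv.isPositiveRadial ha hab)).resolve_right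
      (not_or.2 ⟨not_decaysAhead_Ioo, not_decaysAhead_Ioo⟩)
    rcases eq_or_lt_of_le hr.1 with rfl | har
    · rw [hu.left, hv.left]
    rcases eq_or_lt_of_le hr.2 with rfl | hrb
    · rw [hu.right, hv.right]
    exact heq ⟨har, hrb⟩
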